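/- Let $d\in\{2,3\}$ and $\sigma>0$. There is $\rho_0>0$, depending only on $d$ and $\sigma$, such that the following holds for every $\rho\ge\rho_0$. **Mesh.** Let $\Omega\subset\mathbb R^d$ be a bounded connected open set with $\operatorname{int}\overline\Omega=\Omega$ (for instance a bounded Lipschitz domain), and let $\mathcal T_h$ be a conforming mesh of $\overline\Omega$ by nondegenerate closed simplices that is shape regular: every $K\in\mathcal T_h$ contains a ball of some radius $r>0$ with $\operatorname{diam}K\le\sigma r$. Let $\mathcal E_h$ be the set of edges ($d=2$) or faces ($d=3$) of the mesh. An interior $e\in\mathcal E_h$ is shared by two elements $K^+,K^-$ (in a fixed, arbitrary order), and $\mathbf n_e$ is its unit normal pointing from $K^+$ to $K^-$; on a boundary $e$, $\mathbf n_e$ points out of $\Omega$. For a piecewise smooth $g$ put $[\![g]\!]=g^+-g^-$ and $\{g\}=\frac12(g^++g^-)$ on interior $e$, and $[\![g]\!]=\{g\}=g$ on boundary $e$. Put $h_e=|e|^{1/(d-1)}$. **Spaces.** Let $\mathbf C_h=\{\mathbf v\in[H^1_0(\Omega)]^d:\mathbf v|_K\in[\mathbb P_1(K)]^d\ \forall K\in\mathcal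 T_h\}$, let $\mathbf D_h$ be the set of fields with $\mathbf v|_K=c_K(\mathbf x-\mathbf x_K)$, $c_K\in\mathbb R$, for all $K\in\mathcal T_h$, where $\mathbf x_K$ is the centroid of $K$, and let $\mathbf V_h=\mathbf C_h+\mathbf D_h$. Let $Q_h$ be the space of functions that are constant on each $K\in\mathcal T_h$ and have mean zero on $\Omega$. On $\mathbf V_h$ let $$\|\mathbf v\|_{\mathcal E}=\Big(\sum_{K}\|\nabla\mathbf v\|_{0,K}^2+\rho\sum_{e}h_e^{-1}\|[\![\mathbf v]\!]\|_{0,e}^2\Big)^{1/2},$$ and let $$\mathbf b(\mathbf w,q)=\sum_K(\nabla\cdot\mathbf w,q)_K-\sum_e\langle[\![\mathbf w]\!]\cdot\mathbf n_e,\{q\}\rangle_e .$$ **Reconstruction.** Let $\mathrm{BDM}_1$ be the space of piecewise $[\mathbb P_1]^d$ fields whose normal component is continuous across every interior $e$ (that is, the $H(\mathrm{div},\Omega)$-conforming ones). For every $\mathbf v\in\mathbf V_h$ there is exactly one $\mathcal R\mathbf v\in\mathrm{BDM}_1$ such that, for all $p_1\in\mathbb P_1(e)$, $\int_e\mathcal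 R\mathbf v\cdot\mathbf n_e\,p_1\,ds=\int_e\{\mathbf v\}\cdot\mathbf n_e\,p_1\,ds$ on each interior $e$, and $\int_e\mathcal R\mathbf v\cdot\mathbf n_e\,p_1\,ds=0$ on each boundary $e$. **Well-posedness.** Let $\nu>0$, let $\mathbf f\in[L^2(\Omega)]^d$, and let $\mathbf a^D:\mathbf V_h\times\mathbf V_h\to\mathbb R$ be any bilinear form for which there are constants $\kappa_1^D,\kappa_2^D>0$ with $$\mathbf a^D(\mathbf v,\mathbf v)\ge\kappa_1^D\nu\|\mathbf v\|_{\mathcal E}^2,\qquad|\mathbf a^D(\mathbf v,\mathbf w)|\le\kappa_2^D\nu\|\mathbf v\|_{\mathcal E}\|\mathbf w\|_{\mathcal E}\qquad\forall\,\mathbf v,\mathbf w\in\mathbf V_h .$$ Then the perturbed pressure-robust enriched Galerkin method has exactly one solution: there is a unique $(\mathbf u_h,p_h)\in\mathbf V_h\times Q_h$ such that $$\mathbf a^D(\mathbf u_h,\mathbf v)-\mathbf b(\mathbf v,p_h)=(\mathbf f,\mathcal R\mathbf v)\quad\forall\,\mathbf v\in\mathbf V_h,\qquad\mathbf b(\mathbf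 u_h,q)=0\quad\forall\,q\in Q_h .$$ -/

import Mathlib

open MeasureTheory Filter Topology
open scoped ENNReal ContDiff

noncomputable section

namespace EG

/-- `ℝ^d` with its Euclidean norm. -/
abbrev Space (d : ℕ) : Type := EuclideanSpace ℝ (Fin d)

/-! ### The Sobolev space `[H¹₀(Ω)]^d` -/

/-- Vector fields in `[C_c^∞(Ω)]^d`. -/
structure IsTestField {d : ℕ} (Ω : Set (Space d)) (φ : Space d → Space d) : Prop where
  smooth : ContDiff ℝ ∞ φ
  compact : HasCompactSupport φ
  support : tsupport φ ⊆ Ω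

/-- `u ∈ [H¹₀(Ω)]^d`, the closure of `[C_c^∞(Ω)]^d` in the `H¹` norm: test fields converge to `u` in
`L²(Ω)` while their gradients converge in `L²(Ω)` (the limit `g` is then the weak gradient of
`u`). -/
def MemH10 {d : ℕ} (Ω : Set (Space d)) (u : Space d → Space d) : Prop :=
  MemLp u 2 (volume.restrict Ω) ∧
  ∃ g : Space d → Space d →L[ℝ] Space d, MemLp g 2 (volume.restrict Ω) ∧
    ∃ φ : ℕ → Space d → Space d, (∀ n, IsTestField Ω (φ n)) ∧
      Tendsto (fun n => eLpNorm (φ n - u) 2 (volume.restrict Ω)) atTop (𝓝 0) ∧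
      Tendsto (fun n => eLpNorm (fderiv ℝ (φ n) - g) 2 (volume.restrict Ω)) atTop (𝓝 0)

/-! ### Simplicial meshes -/

/-- A conforming simplicial mesh of `Ω ⊆ ℝ^d`: a finite geometric simplicial complex with
underlying space the closure of `Ω`, all of whose maximal simplices are `d`-dimensional. -/
structure Triangulation {d : ℕ} (Ω : Set (Space d)) where
  complex : Geometry.SimplicialComplex ℝ (Space d)
  finite : complex.faces.Finite
  pure : ∀ s ∈ complex.faces, ∃ t ∈ complex.faces, s ⊆ t ∧ t.card = d + 1
  cover : complex.space = closure Ω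

/-- The elements `K ∈ 𝒯_h`, given by their `d + 1` vertices. -/
def Triangulation.Elem {d : ℕ} {Ω : Set (Space d)} (T : Triangulation Ω) : Type :=
  {K : Finset (Space d) // K ∈ T.complex.faces ∧ K.card = d + 1}

/-- The edges (`d = 2`) or faces (`d = 3`) `e ∈ ℰ_h`, given by their `d` vertices. -/
def Triangulation.Facet {d : ℕ} {Ω : Set (Space d)} (T : Triangulation Ω) : Type :=
  {e : Finset (Space d) // e ∈ T.complex.faces ∧ e.card = d}

instance {d : ℕ} {Ω : Set (Space d)} (T : Triangulation Ω) : Fintype T.Elem :=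
  (T.finite.subset (fun _ h => h.1) :
    {K : Finset (Space d) | K ∈ T.complex.faces ∧ K.card = d + 1}.Finite).fintype

instance {d : ℕ} {Ω : Set (Space d)} (T : Triangulation Ω) : Fintype T.Facet :=
  (T.finite.subset (fun _ h => h.1) :
    {e : Finset (Space d) | e ∈ T.complex.faces ∧ e.card = d}.Finite).fintype

/-- A mesh together with the choice, for every facet `e`, of the neighbouring element `K⁺`. The
unit normal `n_e` points out of `K⁺`. -/
structure Mesh {d : ℕ} (Ω : Set (Space d)) extends Triangulation Ω where
  plus : toTriangulation.Facet → toTriangulation.Elem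
  plus_spec : ∀ e, e.1 ⊆ (plus e).1

namespace Mesh

variable {d : ℕ} {Ω : Set (Space d)} (M : Mesh Ω)

/-- The elements of the mesh. -/
abbrev Elem : Type := M.toTriangulation.Elem

/-- The facets of the mesh. -/
abbrev Facet : Type := M.toTriangulation.Facet

/-- The closed simplex `K`. -/
def cell (K : M.Elem) : Set (Space d) := convexHull ℝ (K.1 : Set (Space d))

/-- The closed edge/face `e`. -/
def face (e : M.Facet) : Set (Space d) := convexHull ℝ (e.1 : Set (Space d))

/-- `h_K ≤ σ r` for some ball of radius `r` inside `K`, for every element `K`. -/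
def ShapeRegular (σ : ℝ) : Prop :=
  ∀ K : M.Elem, ∃ (x : Space d) (r : ℝ), 0 < r ∧ Metric.closedBall x r ⊆ M.cell K ∧
    Metric.diam (M.cell K) ≤ σ * r

/-- The facet is shared by a second element; otherwise it is a boundary facet. -/
def IsInterior (e : M.Facet) : Prop := ∃ K : M.Elem, K ≠ M.plus e ∧ e.1 ⊆ K.1

open Classical in
/-- The element `K⁻` on the other side of an interior facet (on a boundary facet the value is
irrelevant). -/
def minus (e : M.Facet) : M.Elem := if h : M.IsInterior e then h.choose else M.plus e

/-- `n` is the unit normal of the facet `e` pointing out of the element `K ⊇ e`. -/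
def IsOuterNormal (K : M.Elem) (e : M.Facet) (n : Space d) : Prop :=
  ‖n‖ = 1 ∧ (∀ x ∈ e.1, ∀ y ∈ e.1, inner ℝ n (x - y) = 0) ∧
    ∀ x ∈ e.1, ∀ z ∈ K.1, z ∉ e.1 → inner ℝ n (z - x) < 0

/-- The unit normal `n_e`, pointing from `K⁺` to `K⁻`, or out of `Ω` on a boundary facet. -/
def normal (e : M.Facet) : Space d := Classical.epsilon (M.IsOuterNormal (M.plus e) e)

/-- `∫_e g ds`, with the `(d-1)`-dimensional surface measure. -/
def faceIntegral (e : M.Facet) (g : Space d → ℝ) : ℝ :=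
  ∫ x in M.face e, g x ∂(μHE[d - 1] : Measure (Space d))

/-- The length/area `|e|`. -/
def faceMeasure (e : M.Facet) : ℝ := (μHE[d - 1] : Measure (Space d)).real (M.face e)

/-- `h_e = |e|^{1/(d-1)}`. -/
def faceSize (e : M.Facet) : ℝ := M.faceMeasure e ^ (1 / ((d : ℝ) - 1))

/-! ### Piecewise polynomials -/

/-- Piecewise `[ℙ₁]^d` vector fields: one affine field for each element. The trace of `v|_K` on a
facet of `K` is the restriction of `v K`. -/
abbrev BrokenP1 : Type := M.Elem → (Space d →ᵃ[ℝ] Space d)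

open Classical in
/-- The function, defined almost everywhere on `Ω`, that is equal to `g K` inside each element. -/
def glue {X : Type} [AddCommMonoid X] (g : M.Elem → Space d → X) (x : Space d) : X :=
  ∑ K : M.Elem, if x ∈ interior (M.cell K) then g K x else 0

/-- The piecewise affine vector field, as a function on `Ω`. -/
def field (v : M.BrokenP1) : Space d → Space d := M.glue fun K => v K

open Classical in
/-- The jump `⟦g⟧` on the facet `e` of a piecewise defined function. -/
def jump {X : Type} [AddCommGroup X] (g : M.Elem → Space d → X) (e : M.Facet) (x : Space d) : X :=
  if M.IsInterior e then g (M.plus e) x - g (M.minus e) x else g (M.plus e) x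

open Classical in
/-- The average `{g}` on the facet `e` of a piecewise defined function. -/
def avg {X : Type} [AddCommGroup X] [Module ℝ X] (g : M.Elem → Space d → X) (e : M.Facet)
    (x : Space d) : X :=
  if M.IsInterior e then (1 / 2 : ℝ) • (g (M.plus e) x + g (M.minus e) x) else g (M.plus e) x

/-! ### The finite element spaces -/

theorem field_zero : M.field 0 = 0 := by
  funext x; simp [field, glue]

theorem field_add (v w : M.BrokenP1) : M.field (v + w) = M.field v + M.field w := by
  funext x
  simp only [field, glue, Pi.add_apply, AffineMap.coe_add, ← Finset.sum_add_distrib]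
  refine Finset.sum_congr rfl fun K _ => ?_
  split_ifs <;> simp

theorem field_smul (c : ℝ) (v : M.BrokenP1) : M.field (c • v) = c • M.field v := by
  funext x
  simp only [field, glue, Pi.smul_apply, AffineMap.coe_smul, Finset.smul_sum]
  refine Finset.sum_congr rfl fun K _ => ?_
  split_ifs <;> simp

theorem memLp_zero_aux {X : Type} [NormedAddCommGroup X] {μ : Measure (Space d)} :
    MemLp (0 : Space d → X) 2 μ := MemLp.zero

theorem eLpNorm_zero_aux {X : Type} [NormedAddCommGroup X] {μ : Measure (Space d)} :
    Tendsto (fun _ : ℕ => eLpNorm (0 - 0 : Space d → X) 2 μ) atTop (𝓝 0) := by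
  simp

theorem memLp_add_aux {X : Type} [NormedAddCommGroup X] {μ : Measure (Space d)}
    {g k : Space d → X} (hg : MemLp g 2 μ) (hk : MemLp k 2 μ) : MemLp (g + k) 2 μ := hg.add hk

theorem memH10_zero : MemH10 Ω (0 : Space d → Space d) := by
  refine ⟨memLp_zero_aux, 0, memLp_zero_aux, fun _ => 0,
    fun _ => ⟨contDiff_const, .zero, ?_⟩, eLpNorm_zero_aux, ?_⟩
  · simp [tsupport]
  · have : fderiv ℝ (0 : Space d → Space d) = 0 := by funext x; simp
    simp only [this]
    exact eLpNorm_zero_aux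

theorem eLpNorm_tendsto_add {X : Type} [NormedAddCommGroup X] {μ : Measure (Space d)}
    {F G : ℕ → Space d → X} {u w : Space d → X}
    (hF : ∀ n, AEStronglyMeasurable (F n) μ) (hG : ∀ n, AEStronglyMeasurable (G n) μ)
    (hu : AEStronglyMeasurable u μ) (hw : AEStronglyMeasurable w μ)
    (h1 : Tendsto (fun n => eLpNorm (F n - u) 2 μ) atTop (𝓝 0))
    (h2 : Tendsto (fun n => eLpNorm (G n - w) 2 μ) atTop (𝓝 0)) :
    Tendsto (fun n => eLpNorm (F n + G n - (u + w)) 2 μ) atTop (𝓝 0) := by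
  refine tendsto_of_tendsto_of_tendsto_of_le_of_le tendsto_const_nhds
    (by simpa using h1.add h2) (fun _ => zero_le) fun n => ?_
  simp only [add_sub_add_comm]
  exact eLpNorm_add_le ((hF n).sub hu) ((hG n).sub hw) (by norm_num)

theorem eLpNorm_tendsto_smul {X : Type} [NormedAddCommGroup X] [NormedSpace ℝ X]
    {μ : Measure (Space d)} {F : ℕ → Space d → X} {u : Space d → X} (c : ℝ)
    (h : Tendsto (fun n => eLpNorm (F n - u) 2 μ) atTop (𝓝 0)) :
    Tendsto (fun n => eLpNorm (c • F n - c • u) 2 μ) atTop (𝓝 0) := by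
  simp only [← smul_sub, eLpNorm_const_smul]
  simpa using ENNReal.Tendsto.const_mul h (Or.inr (by simp))

theorem memH10_add {u w : Space d → Space d} (hu : MemH10 Ω u) (hw : MemH10 Ω w) :
    MemH10 Ω (u + w) := by
  obtain ⟨hu, g, hg, φ, hφ, h1, h2⟩ := hu
  obtain ⟨hw, k, hk, ψ, hψ, h3, h4⟩ := hw
  have hd : ∀ n, fderiv ℝ (φ n + ψ n) = fderiv ℝ (φ n) + fderiv ℝ (ψ n) := fun n => by
    funext x
    exact fderiv_add ((hφ n).smooth.differentiable (by simp) x)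
      ((hψ n).smooth.differentiable (by simp) x)
  refine ⟨hu.add hw, g + k, memLp_add_aux hg hk, fun n => φ n + ψ n, fun n => ⟨?_, ?_, ?_⟩, ?_, ?_⟩
  · exact (hφ n).smooth.add (hψ n).smooth
  · exact (hφ n).compact.add (hψ n).compact
  · exact (tsupport_add _ _).trans (Set.union_subset (hφ n).support (hψ n).support)
  · exact eLpNorm_tendsto_add (fun n => (hφ n).smooth.continuous.aestronglyMeasurable)
      (fun n => (hψ n).smooth.continuous.aestronglyMeasurable) hu.1 hw.1 h1 h3
  · simp only [hd]
    exact eLpNorm_tendsto_add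
      (fun n => ((hφ n).smooth.continuous_fderiv (by simp)).aestronglyMeasurable)
      (fun n => ((hψ n).smooth.continuous_fderiv (by simp)).aestronglyMeasurable) hg.1 hk.1 h2 h4

theorem memH10_smul (c : ℝ) {u : Space d → Space d} (hu : MemH10 Ω u) : MemH10 Ω (c • u) := by
  obtain ⟨hu, g, hg, φ, hφ, h1, h2⟩ := hu
  have hd : ∀ n, fderiv ℝ (c • φ n) = c • fderiv ℝ (φ n) := fun n => by
    funext x
    exact fderiv_const_smul ((hφ n).smooth.differentiable (by simp) x) c
  refine ⟨hu.const_smul c, c • g, hg.const_smul c, fun n => c • φ n, fun n => ⟨?_, ?_, ?_⟩, ?_, ?_⟩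
  · exact contDiff_const.smul (hφ n).smooth
  · exact (hφ n).compact.smul_left (f := fun _ => c)
  · exact (closure_mono (Function.support_const_smul_subset c (φ n))).trans (hφ n).support
  · exact eLpNorm_tendsto_smul c h1
  · simp only [hd]
    exact eLpNorm_tendsto_smul c h2

/-- `C_h`: the piecewise affine fields in `[H¹₀(Ω)]^d`. -/
def spaceC : Submodule ℝ M.BrokenP1 where
  carrier := {v | MemH10 Ω (M.field v)}
  zero_mem' := by
    simp only [Set.mem_ofPred_eq, field_zero]
    exact memH10_zero
  add_mem' := fun {v w} hv hw => by
    simp only [Set.mem_ofPred_eq, field_add] at hv hw ⊢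
    exact memH10_add hv hw
  smul_mem' := fun c v hv => by
    simp only [Set.mem_ofPred_eq, field_smul] at hv ⊢
    exact memH10_smul c hv

/-- The centroid `x_K`. -/
def centroid (K : M.Elem) : Space d := K.1.centroid ℝ id

/-- `D_h`: the fields equal to `c_K (x - x_K)` on each element `K`. -/
def spaceD : Submodule ℝ M.BrokenP1 where
  carrier := {v | ∃ c : M.Elem → ℝ, ∀ K x, v K x = c K • (x - M.centroid K)}
  zero_mem' := ⟨0, by simp⟩
  add_mem' := by
    rintro v w ⟨a, ha⟩ ⟨b, hb⟩
    exact ⟨a + b, fun K x => by simp [ha, hb, add_smul]⟩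
  smul_mem' := by
    rintro c v ⟨a, ha⟩
    exact ⟨c • a, fun K x => by simp [ha, mul_smul]⟩

/-- The velocity space `V_h = C_h ⊕ D_h`. -/
def velocity : Submodule ℝ M.BrokenP1 := M.spaceC ⊔ M.spaceD

/-- Piecewise constants. -/
abbrev BrokenP0 : Type := M.Elem → ℝ

/-- The pressure space `Q_h`: piecewise constants `q` with `(q, 1) = 0`. -/
def pressure : Submodule ℝ M.BrokenP0 where
  carrier := {q | ∑ K, ∫ _ in M.cell K, q K = 0}
  zero_mem' := by simp
  add_mem' := fun {p q} hp hq => by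
    simp only [Set.mem_ofPred_eq, integral_const, smul_eq_mul, Pi.add_apply, mul_add,
      Finset.sum_add_distrib] at hp hq ⊢
    rw [hp, hq, add_zero]
  smul_mem' := fun c q hq => by
    simp only [Set.mem_ofPred_eq, integral_const, smul_eq_mul, Pi.smul_apply, mul_left_comm _ c,
      ← Finset.mul_sum] at hq ⊢
    rw [hq, mul_zero]

/-! ### The forms, the mesh-dependent norm and the velocity reconstruction -/

/-- The squared Frobenius norm of a gradient. -/
def frobSq (L : Space d →ₗ[ℝ] Space d) : ℝ := ∑ i, ‖L (EuclideanSpace.single i 1)‖ ^ 2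

/-- The mesh-dependent norm
`(‖∇v‖²_{0,𝒯_h} + ρ ‖h_e^{-1/2} ⟦v⟧‖²_{0,ℰ_h})^{1/2}`. The gradient of `v` on `K` is the linear part
of `v K`. -/
def energyNorm (ρ : ℝ) (v : M.BrokenP1) : ℝ :=
  Real.sqrt ((∑ K, ∫ _ in M.cell K, frobSq (v K).linear) +
    ρ * ∑ e, M.faceIntegral e fun x => (M.faceSize e)⁻¹ * ‖M.jump (fun K => v K) e x‖ ^ 2)

/-- `b(w, q) = (∇·w, q)_{𝒯_h} - ⟨⟦w⟧·n_e, {q}⟩_{ℰ_h}`. -/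
def formB (w : M.BrokenP1) (q : M.BrokenP0) : ℝ :=
  (∑ K, ∫ _ in M.cell K, LinearMap.trace ℝ (Space d) (w K).linear * q K) -
    ∑ e, M.faceIntegral e fun x =>
      inner ℝ (M.jump (fun K => w K) e x) (M.normal e) * M.avg (fun K _ => q K) e x

/-- The Brezzi–Douglas–Marini space `BDM₁`: piecewise `[ℙ₁]^d` fields whose normal component is
continuous across every interior facet. -/
def BDM1 : Set M.BrokenP1 :=
  {w | ∀ e, M.IsInterior e → ∀ x ∈ M.face e,
    inner ℝ (w (M.plus e) x) (M.normal e) = inner ℝ (w (M.minus e) x) (M.normal e)}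

/-- `r = ℛv`: `r ∈ BDM₁`, the first normal moments of `r` on interior facets are those of `{v}`, and
those on boundary facets vanish. -/
def IsReconstruction (v r : M.BrokenP1) : Prop :=
  r ∈ M.BDM1 ∧
  (∀ e, M.IsInterior e → ∀ p : Space d →ᵃ[ℝ] ℝ,
    M.faceIntegral e (fun x => inner ℝ (r (M.plus e) x) (M.normal e) * p x) =
      M.faceIntegral e (fun x => inner ℝ (M.avg (fun K => v K) e x) (M.normal e) * p x)) ∧
  (∀ e, ¬ M.IsInterior e → ∀ p : Space d →ᵃ[ℝ] ℝ,
    M.faceIntegral e (fun x => inner ℝ (r (M.plus e) x) (M.normal e) * p x) = 0)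

/-- The velocity reconstruction operator `ℛ`. -/
def reconstruct (v : M.BrokenP1) : M.BrokenP1 := Classical.epsilon (M.IsReconstruction v)

/-- The load `(f, ℛv)`. -/
def load (f : Space d → Space d) (v : M.BrokenP1) : ℝ :=
  ∫ x in Ω, inner ℝ (f x) (M.field (M.reconstruct v) x)

/-- `(u, p) ∈ V_h × Q_h` solves the perturbed pressure-robust EG method with velocity form `aD`. -/
def IsSolution (aD : M.velocity →ₗ[ℝ] M.velocity →ₗ[ℝ] ℝ) (f : Space d → Space d)
    (u : M.velocity) (p : M.pressure) : Prop :=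
  (∀ v : M.velocity, aD u v - M.formB v p = M.load f v) ∧
  (∀ q : M.pressure, M.formB u q = 0)

end Mesh

end EG

end

namespace EG

/-! ### Barycentric coordinates and cones -/

section General

variable {ι E F : Type*} [NormedAddCommGroup E] [InnerProductSpace ℝ E] [AddCommGroup F] [Module ℝ F]

/-! The discrete problem is a square linear system, so it is enough that the homogeneous system has
only the zero solution (`existsUnique_saddlePoint`). No quantitative inf-sup bound enters.

Velocity: testing the momentum equation with `u` itself removes the pressure term, and coercivity
makes the energy norm of `u` vanish. Then `u` is constant on each element, the constants agree
across interior facets, and they are zero next to a boundary facet. Since the dual graph is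
connected (`eq_univ_of_adjacent_mem`) and some facet is a boundary facet (`exists_not_isInterior`),
`u = 0`.

Pressure: what remains is `b(v, q) = 0` for all `v`. On the enrichment function `x - x_K` of one
element, `b` equals a positive multiple of the sum over the facets of `K` of `q_K - {q}`
(`formB_enrichment`). This is a graph Laplacian on the dual graph, so the maximum principle makes
`q` constant, and the zero mean gives `q = 0` (`pressure_eq_zero`).

Reconstruction: at a vertex of `K`, the normals of the `d` facets of `K` through it form a basis, so
an affine field on `K` is determined by arbitrary normal components at the vertices of each facet
(`existsUnique_isReconstruction`). Uniqueness makes `ℛ` linear, hence the load is a linear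
functional.

All surface integrals rest on one geometric fact: an element is a cone over each of its facets, so
height times facet measure is `d` times its volume (`volume_cone`). Hence facets have positive
finite measure, and the flux of `x - a` through a facet is `d |K|` times a barycentric coordinate of
`a`. -/

theorem affineMap_apply_eq_sum_coord [Fintype ι] (b : AffineBasis ι ℝ E) (f : E →ᵃ[ℝ] F) (x : E) :
    f x = ∑ i, b.coord i x • f (b i) := by
  conv_lhs => rw [← b.affineCombination_coord_eq_self x]
  rw [Finset.map_affineCombination _ _ _ (b.sum_coord_apply_eq_one x),
    Finset.affineCombination_eq_linear_combination _ _ _ (b.sum_coord_apply_eq_one x)]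
  rfl

theorem affineMap_ext_basis [Fintype ι] (b : AffineBasis ι ℝ E) {f g : E →ᵃ[ℝ] F}
    (h : ∀ i, f (b i) = g (b i)) : f = g := by
  ext x
  rw [affineMap_apply_eq_sum_coord b f, affineMap_apply_eq_sum_coord b g]
  simp [h]

/-- An affine map with prescribed values at the points of an affine basis. -/
theorem exists_affineMap_basis [Fintype ι] (b : AffineBasis ι ℝ E) (c : ι → F) :
    ∃ f : E →ᵃ[ℝ] F, ∀ i, f (b i) = c i := by
  classical
  refine ⟨∑ i, ((LinearMap.toSpanSingleton ℝ F (c i)).toAffineMap.comp (b.coord i)), fun i => ?_⟩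
  have key : ∀ (t : Finset ι) (x : E),
      (∑ j ∈ t, ((LinearMap.toSpanSingleton ℝ F (c j)).toAffineMap.comp (b.coord j)) :
        E →ᵃ[ℝ] F) x = ∑ j ∈ t, b.coord j x • c j := by
    intro t x
    induction t using Finset.induction_on with
    | empty => simp
    | insert a t ha ih => simp [Finset.sum_insert ha, ih]
  rw [key]
  simp [b.coord_apply]

theorem convexHull_inner_eq {s : Set E} {n : E} {c : ℝ} (h : ∀ y ∈ s, inner ℝ n y = c) {x : E}
    (hx : x ∈ convexHull ℝ s) : inner ℝ n x = c := by
  have hconv : Convex ℝ {x : E | inner ℝ n x = c} := by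
    have := (convex_singleton (𝕜 := ℝ) c).linear_preimage (innerₛₗ ℝ n)
    exact this
  exact convexHull_min (fun y hy => h y hy) hconv hx

/-- The cross sections of a cone orthogonal to its axis are homothetic to its base. -/
theorem cone_inter_slice {A : Set E} {z n : E} {h s : ℝ} (hn : ‖n‖ = 1) (hh : 0 < h)
    (hA : ∀ y ∈ A, inner ℝ n (y - z) = h) (hs : 0 < s) (hsh : s ≤ h) :
    convexJoin ℝ {z} A ∩ AffineSubspace.mk' (s • n +ᵥ z) (Submodule.span ℝ {n})ᗮ
      = AffineMap.homothety z (s / h) '' A := by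
  have hnn : inner ℝ n n = (1 : ℝ) := by rw [real_inner_self_eq_norm_sq, hn]; norm_num
  have hmem : ∀ x : E, x ∈ (AffineSubspace.mk' (s • n +ᵥ z) (Submodule.span ℝ {n})ᗮ : Set E) ↔
      inner ℝ n (x - z) = s := by
    intro x
    rw [SetLike.mem_coe, AffineSubspace.mem_mk', Submodule.mem_orthogonal_singleton_iff_inner_right]
    simp only [vsub_eq_sub, vadd_eq_add]
    rw [show x - (s • n + z) = (x - z) - s • n by abel, inner_sub_right, inner_smul_right, hnn]
    constructor <;> intro h <;> linarith
  ext x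
  rw [Set.mem_inter_iff, hmem, mem_convexJoin]
  simp only [Set.mem_singleton_iff, exists_eq_left, Set.mem_image, AffineMap.homothety_apply,
    vsub_eq_sub, vadd_eq_add]
  constructor
  · rintro ⟨⟨y, hy, hx⟩, hxs⟩
    rw [segment_eq_image'] at hx
    obtain ⟨t, -, rfl⟩ := hx
    simp only [add_sub_cancel_left, inner_smul_right, hA y hy] at hxs
    refine ⟨y, hy, ?_⟩
    rw [← hxs, mul_div_assoc, div_self hh.ne', mul_one, add_comm]
  · rintro ⟨y, hy, rfl⟩
    refine ⟨⟨y, hy, ?_⟩, ?_⟩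
    · rw [segment_eq_image']
      exact ⟨s / h, ⟨by positivity, by rw [div_le_one hh]; exact hsh⟩, by simp [add_comm]⟩
    · simp only [add_sub_cancel_right, inner_smul_right, hA y hy]
      field_simp

theorem cone_inter_slice_eq_empty {A : Set E} {z n : E} {h s : ℝ} (hn : ‖n‖ = 1) (hh : 0 < h)
    (hA : ∀ y ∈ A, inner ℝ n (y - z) = h) (hs : s < 0 ∨ h < s) :
    convexJoin ℝ {z} A ∩ AffineSubspace.mk' (s • n +ᵥ z) (Submodule.span ℝ {n})ᗮ = ∅ := by
  have hnn : inner ℝ n n = (1 : ℝ) := by rw [real_inner_self_eq_norm_sq, hn]; norm_num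
  rw [Set.eq_empty_iff_forall_notMem]
  rintro x ⟨hx, hxs⟩
  rw [SetLike.mem_coe, AffineSubspace.mem_mk',
    Submodule.mem_orthogonal_singleton_iff_inner_right] at hxs
  simp only [vsub_eq_sub, vadd_eq_add] at hxs
  rw [show x - (s • n + z) = (x - z) - s • n by abel, inner_sub_right, inner_smul_right, hnn] at hxs
  rw [mem_convexJoin] at hx
  simp only [Set.mem_singleton_iff, exists_eq_left] at hx
  obtain ⟨y, hy, hx⟩ := hx
  rw [segment_eq_image'] at hx
  obtain ⟨t, ⟨ht0, ht1⟩, rfl⟩ := hx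
  simp only [add_sub_cancel_left, inner_smul_right, hA y hy] at hxs
  rcases hs with hs | hs <;> nlinarith

theorem lintegral_Ioc_pow_div {h : ℝ} (hh : 0 < h) (m : ℕ) :
    ∫⁻ s in Set.Ioc 0 h, ENNReal.ofReal ((s / h) ^ m) = ENNReal.ofReal (h / (m + 1)) := by
  rw [← ofReal_integral_eq_lintegral_ofReal]
  · rw [← intervalIntegral.integral_of_le hh.le]
    congr 1
    simp only [div_pow, intervalIntegral.integral_div, integral_pow]
    field_simp
    simp [pow_succ]
  · exact (Continuous.integrableOn_Icc (by fun_prop)).mono_set Set.Ioc_subset_Icc_self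
  · filter_upwards [ae_restrict_mem measurableSet_Ioc] with s hs
    have := hs.1.le
    simp only [Pi.zero_apply]
    positivity

/-- The volume of a cone is its height times the measure of its base divided by the dimension. -/
theorem volume_cone {d : ℕ} [NeZero d] {A : Set (Space d)} {z n : Space d} {h : ℝ} (hn : ‖n‖ = 1)
    (hh : 0 < h) (hA : ∀ y ∈ A, inner ℝ n (y - z) = h)
    (hmeas : MeasurableSet (convexJoin ℝ {z} A)) :
    volume (convexJoin ℝ {z} A) =
      ENNReal.ofReal (h / d) * (μHE[d - 1] : Measure (Space d)) A := by
  have hd : d ≠ 0 := NeZero.ne d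
  have hn0 : n ≠ 0 := by rintro rfl; simp at hn
  -- Cavalieri: integrate the measures of the slices orthogonal to `n`. The slice at distance `s`
  -- from the apex is the base scaled by `s / h`, which contributes `(s / h) ^ (d - 1)`.
  have key := EuclideanGeometry.euclideanHausdorffMeasure_eq_lintegral z hn0 hmeas
  rw [InnerProductSpace.euclideanHausdorffMeasure_eq_volume, finrank_euclideanSpace_fin] at key
  have hne : ‖n‖ₑ = 1 := by rw [← ofReal_norm, hn]; simp
  rw [key, hne, one_mul]
  have hae : (fun s : ℝ => (μHE[d - 1] : Measure (Space d)) (convexJoin ℝ {z} A ∩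
      AffineSubspace.mk' (s • n +ᵥ z) (Submodule.span ℝ {n})ᗮ)) =ᵐ[volume]
      (Set.Ioc 0 h).indicator fun s => ENNReal.ofReal ((s / h) ^ (d - 1)) *
        (μHE[d - 1] : Measure (Space d)) A := by
    -- At `s = 0` neither slice lemma applies; a single value of `s` is negligible.
    have h0 : ∀ᵐ s : ℝ, s ≠ 0 := by
      simp [ae_iff]
    filter_upwards [h0] with s hs
    by_cases hmem : s ∈ Set.Ioc 0 h
    · rw [Set.indicator_of_mem hmem, cone_inter_slice hn hh hA hmem.1 hmem.2,
        euclideanHausdorffMeasure_homothety_image _ _ (div_pos hmem.1 hh).ne']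
      rw [ENNReal.smul_def, smul_eq_mul]
      congr 1
      rw [ENNReal.ofReal_pow (div_pos hmem.1 hh).le, ENNReal.coe_pow]
      congr 1
      rw [← ENNReal.ofReal_coe_nnreal]
      simp [abs_of_pos hmem.1, abs_of_pos hh]
    · rw [Set.indicator_of_notMem hmem, cone_inter_slice_eq_empty hn hh hA, measure_empty]
      rw [Set.mem_Ioc, not_and_or, not_lt, not_le] at hmem
      exact hmem.imp (fun h => lt_of_le_of_ne h hs) id
  rw [lintegral_congr_ae hae, lintegral_indicator measurableSet_Ioc,
    lintegral_mul_const _ (by fun_prop), lintegral_Ioc_pow_div hh]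
  congr 3
  have : ((d - 1 : ℕ) : ℝ) + 1 = d := by
    exact_mod_cast Nat.succ_pred_eq_of_ne_zero hd
  rw [this]

end General

namespace Mesh

variable {d : ℕ} {Ω : Set (Space d)} (M : Mesh Ω)

/-! ### Elements and their facets -/

/-- The vertices of an element as an affine basis of the space. -/
noncomputable def basis (K : M.Elem) : AffineBasis K.1 ℝ (Space d) where
  toFun := Subtype.val
  ind' := M.complex.indep K.2.1
  tot' := by
    rw [(M.complex.indep K.2.1).affineSpan_eq_top_iff_card_eq_finrank_add_one]
    simp [K.2.2]

@[simp]
theorem basis_apply (K : M.Elem) (z : K.1) : M.basis K z = z := rfl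

theorem range_basis (K : M.Elem) : Set.range (M.basis K) = (K.1 : Set (Space d)) :=
  Subtype.range_coe

theorem coord_self (K : M.Elem) (z : K.1) : (M.basis K).coord z (z : Space d) = 1 :=
  (M.basis K).coord_apply_eq z

theorem coord_of_ne (K : M.Elem) {z w : K.1} (h : z ≠ w) :
    (M.basis K).coord z (w : Space d) = 0 :=
  (M.basis K).coord_apply_ne h

theorem mem_cell_iff (K : M.Elem) (x : Space d) :
    x ∈ M.cell K ↔ ∀ z, 0 ≤ (M.basis K).coord z x := by
  rw [cell, ← M.range_basis K, AffineBasis.convexHull_eq_nonneg_coord]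
  rfl

theorem interior_cell_nonempty (K : M.Elem) : (interior (M.cell K)).Nonempty := by
  have : Nonempty K.1 := Fintype.card_pos_iff.1 (by simp [K.2.2])
  exact ⟨_, by
    have := (M.basis K).centroid_mem_interior_convexHull
    rwa [M.range_basis K] at this⟩

theorem isCompact_cell (K : M.Elem) : IsCompact (M.cell K) :=
  K.1.finite_toSet.isCompact_convexHull ℝ

theorem isCompact_face (e : M.Facet) : IsCompact (M.face e) :=
  e.1.finite_toSet.isCompact_convexHull ℝ

theorem volume_cell_pos (K : M.Elem) : 0 < volume (M.cell K) :=
  Measure.measure_pos_of_nonempty_interior _ (M.interior_cell_nonempty K)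

theorem volume_cell_lt_top (K : M.Elem) : volume (M.cell K) < ⊤ :=
  (M.isCompact_cell K).measure_lt_top

theorem volumeReal_cell_pos (K : M.Elem) : 0 < volume.real (M.cell K) :=
  ENNReal.toReal_pos (M.volume_cell_pos K).ne' (M.volume_cell_lt_top K).ne

/-- The facets of the element `K`. -/
noncomputable def facetsOf (K : M.Elem) : Finset M.Facet := by
  classical exact Finset.univ.filter fun e => e.1 ⊆ K.1

theorem mem_facetsOf {K : M.Elem} {e : M.Facet} : e ∈ M.facetsOf K ↔ e.1 ⊆ K.1 := by
  simp [facetsOf]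

theorem facet_nonempty (e : M.Facet) : e.1.Nonempty :=
  M.complex.nonempty_of_mem_faces e.2.1

theorem IsOuterNormal.inner_face {M : Mesh Ω} {K : M.Elem} {e : M.Facet} {n : Space d}
    (hn : M.IsOuterNormal K e n) {x y : Space d} (hx : x ∈ M.face e) (hy : y ∈ e.1) :
    inner ℝ n x = inner ℝ n y :=
  convexHull_inner_eq (fun w hw => by
    have := hn.2.1 w hw y hy
    rw [inner_sub_right] at this
    linarith) hx

section NeZero

variable [NeZero d]

open Classical in
/-- The facet of `K` opposite to the vertex `z`. -/
noncomputable def oppFacet (K : M.Elem) (z : K.1) : M.Facet :=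
  ⟨K.1.erase z, by
    have hc : (K.1.erase z).card = d := by rw [Finset.card_erase_of_mem z.2, K.2.2]; simp
    refine ⟨M.complex.down_closed K.2.1 (Finset.erase_subset _ _) ?_, hc⟩
    rw [← Finset.card_pos, hc]
    exact Nat.pos_of_ne_zero (NeZero.ne d)⟩

theorem mem_oppFacet {K : M.Elem} {z : K.1} {y : Space d} :
    y ∈ (M.oppFacet K z).1 ↔ y ≠ z ∧ y ∈ K.1 := by
  classical
  simp [oppFacet]

theorem oppFacet_subset (K : M.Elem) (z : K.1) : (M.oppFacet K z).1 ⊆ K.1 :=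
  fun _ hy => (M.mem_oppFacet.1 hy).2

theorem oppFacet_injective (K : M.Elem) : Function.Injective (M.oppFacet K) := by
  intro z w h
  by_contra hne
  have : (z : Space d) ∈ (M.oppFacet K w).1 := M.mem_oppFacet.2 ⟨fun h => hne (Subtype.ext h), z.2⟩
  rw [← h] at this
  exact (M.mem_oppFacet.1 this).1 rfl

theorem exists_eq_oppFacet {K : M.Elem} {e : M.Facet} (h : e.1 ⊆ K.1) :
    ∃ z, e = M.oppFacet K z := by
  classical
  obtain ⟨z, hz, hze⟩ := Finset.exists_mem_notMem_of_card_lt_card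
    (show e.1.card < K.1.card by rw [e.2.2, K.2.2]; exact Nat.lt_succ_self d)
  refine ⟨⟨z, hz⟩, Subtype.ext (Finset.eq_of_subset_of_card_le (fun y hy => ?_) ?_)⟩
  · exact M.mem_oppFacet.2 ⟨fun hyz => hze (by rwa [hyz] at hy), h hy⟩
  · rw [(M.oppFacet K ⟨z, hz⟩).2.2, e.2.2]

theorem sum_facetsOf {X : Type*} [AddCommMonoid X] (K : M.Elem) (F : M.Facet → X) :
    ∑ e ∈ M.facetsOf K, F e = ∑ z, F (M.oppFacet K z) := by
  classical
  rw [← Finset.sum_image (s := Finset.univ) (g := M.oppFacet K)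
    (fun z _ w _ h => M.oppFacet_injective K h)]
  refine Finset.sum_congr (Finset.ext fun e => ?_) fun _ _ => rfl
  rw [mem_facetsOf, Finset.mem_image]
  constructor
  · intro h
    obtain ⟨z, rfl⟩ := M.exists_eq_oppFacet h
    exact ⟨z, Finset.mem_univ _, rfl⟩
  · rintro ⟨z, -, rfl⟩
    exact M.oppFacet_subset K z

theorem card_facetsOf (K : M.Elem) : (M.facetsOf K).card = d + 1 := by
  rw [Finset.card_eq_sum_ones, sum_facetsOf]
  simp [K.2.2]

/-- Brings an element into the form required by `volume_cone`. -/
theorem cell_eq_convexJoin (K : M.Elem) (z : K.1) :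
    M.cell K = convexJoin ℝ {(z : Space d)} (M.face (M.oppFacet K z)) := by
  classical
  rw [face, ← convexHull_insert (M.facet_nonempty _), cell]
  congr 1
  ext y
  simp only [Finset.mem_coe, Set.mem_insert_iff, mem_oppFacet]
  by_cases h : y = z
  · simp [h]
  · simp [h]

/-! ### Outer normals -/

/-- The barycentric coordinate of `z` is 0 on the opposite facet and 1 at `z`, so minus its
normalised gradient is the outer normal. -/
theorem exists_isOuterNormal_oppFacet (K : M.Elem) (z : K.1) :
    ∃ n, M.IsOuterNormal K (M.oppFacet K z) n := by
  set l := ((M.basis K).coord z).linear with hl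
  set g := (InnerProductSpace.toDual ℝ (Space d)).symm l.toContinuousLinearMap with hg
  have hgv : ∀ x y, inner ℝ g (x - y) = (M.basis K).coord z x - (M.basis K).coord z y := by
    intro x y
    rw [hg, InnerProductSpace.toDual_symm_apply]
    simpa [hl] using ((M.basis K).coord z).linearMap_vsub x y
  obtain ⟨y, hy⟩ := M.facet_nonempty (M.oppFacet K z)
  have hcoord : ∀ y ∈ (M.oppFacet K z).1, (M.basis K).coord z y = 0 := fun y hy => by
    obtain ⟨h1, h2⟩ := M.mem_oppFacet.1 hy
    exact M.coord_of_ne K (w := ⟨y, h2⟩) fun h => h1 (by rw [h])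
  have hg0 : g ≠ 0 := by
    intro h0
    have := hgv z y
    rw [h0, inner_zero_left, hcoord y hy, M.coord_self] at this
    norm_num at this
  have hpos : 0 < ‖g‖ := norm_pos_iff.2 hg0
  refine ⟨-(‖g‖⁻¹ • g), ?_, fun x hx y hy => ?_, fun x hx w hw hwe => ?_⟩
  · rw [norm_neg, norm_smul, norm_inv, norm_norm, inv_mul_cancel₀ hpos.ne']
  · rw [inner_neg_left, real_inner_smul_left, hgv, hcoord x hx, hcoord y hy]
    simp
  · have : w = z := by
      by_contra h
      exact hwe (M.mem_oppFacet.2 ⟨h, hw⟩)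
    rw [inner_neg_left, real_inner_smul_left, hgv, hcoord x hx, this, M.coord_self]
    simpa using hpos

theorem exists_isOuterNormal {K : M.Elem} {e : M.Facet} (h : e.1 ⊆ K.1) :
    ∃ n, M.IsOuterNormal K e n := by
  obtain ⟨z, rfl⟩ := M.exists_eq_oppFacet h
  exact M.exists_isOuterNormal_oppFacet K z

theorem normal_spec (e : M.Facet) : M.IsOuterNormal (M.plus e) e (M.normal e) :=
  Classical.epsilon_spec (M.exists_isOuterNormal (M.plus_spec e))

variable {M}

theorem IsOuterNormal.inner_pos {K : M.Elem} {z : K.1} {n : Space d}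
    (hn : M.IsOuterNormal K (M.oppFacet K z) n) {y : Space d} (hy : y ∈ (M.oppFacet K z).1) :
    0 < inner ℝ n (y - z) := by
  have := hn.2.2 y hy z z.2 fun h => (M.mem_oppFacet.1 h).1 rfl
  rw [← neg_sub, inner_neg_right]
  linarith

/-- The distance to the hyperplane of a facet is a multiple of a barycentric coordinate. -/
theorem IsOuterNormal.inner_eq_mul_coord {K : M.Elem} {z : K.1} {n : Space d}
    (hn : M.IsOuterNormal K (M.oppFacet K z) n) {y : Space d} (hy : y ∈ (M.oppFacet K z).1)
    (x : Space d) : inner ℝ n (y - x) = inner ℝ n (y - z) * (M.basis K).coord z x := by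
  have h1 := affineMap_apply_eq_sum_coord (M.basis K) (innerₛₗ ℝ n).toAffineMap x
  simp only [LinearMap.coe_toAffineMap, innerₛₗ_apply_apply, basis_apply, smul_eq_mul] at h1
  -- All vertices other than `z` lie in one hyperplane orthogonal to `n`, so only the coordinate of
  -- `z` survives.
  have h2 : ∀ w : K.1, (M.basis K).coord w x * inner ℝ n (w : Space d) =
      (M.basis K).coord w x * inner ℝ n y -
        if w = z then (M.basis K).coord z x * inner ℝ n (y - z) else 0 := by
    intro w
    split_ifs with h
    · rw [h, inner_sub_right]; ring
    · have hw : (w : Space d) ∈ (M.oppFacet K z).1 :=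
        M.mem_oppFacet.2 ⟨fun h' => h (Subtype.ext h'), w.2⟩
      have := hn.2.1 _ hw _ hy
      rw [inner_sub_right] at this
      rw [show inner ℝ n (w : Space d) = inner ℝ n y by linarith]; ring
  rw [Finset.sum_congr rfl fun w _ => h2 w, Finset.sum_sub_distrib, ← Finset.sum_mul,
    (M.basis K).sum_coord_apply_eq_one, Finset.sum_ite_eq' Finset.univ z] at h1
  simp only [Finset.mem_univ, if_true] at h1
  rw [inner_sub_right, h1]
  ring

theorem IsOuterNormal.volume_cell {K : M.Elem} {z : K.1} {n : Space d}
    (hn : M.IsOuterNormal K (M.oppFacet K z) n) {y : Space d} (hy : y ∈ (M.oppFacet K z).1) :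
    volume (M.cell K) = ENNReal.ofReal (inner ℝ n (y - z) / d) *
      (μHE[d - 1] : Measure (Space d)) (M.face (M.oppFacet K z)) := by
  have hc := (M.isCompact_cell K).measurableSet
  rw [M.cell_eq_convexJoin K z] at hc ⊢
  refine volume_cone hn.1 (hn.inner_pos hy) (fun x hx => ?_) hc
  rw [inner_sub_right, inner_sub_right, hn.inner_face hx hy]

variable (M)

/-- The volume of the element is a positive finite number and factors as height over `d` times the
facet measure, so neither degenerate value is possible. -/
theorem measure_face_ne_zero_and_ne_top (e : M.Facet) :
    (μHE[d - 1] : Measure (Space d)) (M.face e) ≠ 0 ∧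
      (μHE[d - 1] : Measure (Space d)) (M.face e) ≠ ⊤ := by
  suffices h : ∀ (K : M.Elem) (z : K.1), (μHE[d - 1] : Measure (Space d))
      (M.face (M.oppFacet K z)) ≠ 0 ∧
      (μHE[d - 1] : Measure (Space d)) (M.face (M.oppFacet K z)) ≠ ⊤ by
    obtain ⟨z, hz⟩ := M.exists_eq_oppFacet (M.plus_spec e)
    rw [hz]
    exact h _ z
  intro K z
  obtain ⟨n, hn⟩ := M.exists_isOuterNormal_oppFacet K z
  obtain ⟨y, hy⟩ := M.facet_nonempty (M.oppFacet K z)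
  have hv := hn.volume_cell hy
  have h1 := M.volume_cell_pos K
  have h2 := M.volume_cell_lt_top K
  rw [hv] at h1 h2
  refine ⟨fun h => by simp [h] at h1, fun h => ?_⟩
  rw [h, ENNReal.mul_top (left_ne_zero_of_mul h1.ne')] at h2
  exact lt_irrefl _ h2

theorem faceMeasure_pos (e : M.Facet) : 0 < M.faceMeasure e :=
  ENNReal.toReal_pos (M.measure_face_ne_zero_and_ne_top e).1 (M.measure_face_ne_zero_and_ne_top e).2

variable {M}

/-- The signed volume of the cone over a facet of `K` with apex `x`, expressed by a barycentric
coordinate of `x`. -/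
theorem IsOuterNormal.faceMeasure_mul_inner {K : M.Elem} {z : K.1} {n : Space d}
    (hn : M.IsOuterNormal K (M.oppFacet K z) n) {y : Space d} (hy : y ∈ M.face (M.oppFacet K z))
    (x : Space d) : M.faceMeasure (M.oppFacet K z) * inner ℝ n (y - x) =
      d * volume.real (M.cell K) * (M.basis K).coord z x := by
  obtain ⟨w, hw⟩ := M.facet_nonempty (M.oppFacet K z)
  have hd : (d : ℝ) ≠ 0 := by exact_mod_cast NeZero.ne d
  have hpos := hn.inner_pos hw
  have hv : volume.real (M.cell K) = inner ℝ n (w - z) / d * M.faceMeasure (M.oppFacet K z) := by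
    rw [measureReal_def, hn.volume_cell hw, ENNReal.toReal_mul, ENNReal.toReal_ofReal (by positivity)]
    rfl
  rw [hv, inner_sub_right, hn.inner_face hy hw, ← inner_sub_right, hn.inner_eq_mul_coord hw]
  field_simp

end NeZero

end Mesh

/-! ### Points in general position -/

theorem affineSpan_finset_ne_top {d : ℕ} {t : Finset (Space d)} (ht : t.card ≤ d) :
    affineSpan ℝ (t : Set (Space d)) ≠ ⊤ := by
  intro h
  rcases t.eq_empty_or_nonempty with rfl | hne
  · simp only [Finset.coe_empty, AffineSubspace.span_empty] at h
    exact bot_ne_top h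
  have hpos := hne.card_pos
  have hle := finrank_vectorSpan_range_le ℝ ((↑) : t → Space d) (n := t.card - 1)
    (by rw [Fintype.card_coe]; omega)
  rw [Subtype.range_coe_subtype, show {x | x ∈ t} = (t : Set (Space d)) from rfl,
    ← direction_affineSpan, h, AffineSubspace.direction_top, finrank_top,
    finrank_euclideanSpace_fin] at hle
  omega

/-- At most `d` points span a proper affine subspace, which is Lebesgue null; finitely many of them
cannot cover a nonempty open set. -/
theorem exists_mem_notMem_affineSpan {d : ℕ} {O : Set (Space d)} (hO : IsOpen O)
    (hne : O.Nonempty) {F : Set (Finset (Space d))} (hF : F.Finite) (hcard : ∀ s ∈ F, s.card ≤ d) :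
    ∃ a ∈ O, ∀ s ∈ F, a ∉ affineSpan ℝ (s : Set (Space d)) := by
  by_contra! hcon
  have hnull : volume (⋃ s ∈ F, (affineSpan ℝ (s : Set (Space d)) : Set (Space d))) = 0 := by
    rw [measure_biUnion_null_iff hF.countable]
    exact fun s hs => Measure.addHaar_affineSubspace _ _ (affineSpan_finset_ne_top (hcard s hs))
  refine (hO.measure_pos volume hne).ne' (measure_mono_null (fun a ha => ?_) hnull)
  obtain ⟨s, hs, has⟩ := hcon a ha
  exact Set.mem_biUnion hs has

namespace Mesh

variable {d : ℕ} {Ω : Set (Space d)} (M : Mesh Ω)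

/-! ### Connectedness of the dual graph -/

theorem closure_eq_iUnion_cell : closure Ω = ⋃ K, M.cell K := by
  rw [← M.cover]
  ext x
  rw [Geometry.SimplicialComplex.mem_space_iff, Set.mem_iUnion]
  constructor
  · rintro ⟨s, hs, hx⟩
    obtain ⟨t, ht, hst, hc⟩ := M.pure s hs
    exact ⟨⟨t, ht, hc⟩, convexHull_mono (Finset.coe_subset.2 hst) hx⟩
  · rintro ⟨K, hx⟩
    exact ⟨K.1, K.2.1, hx⟩

theorem convex_cell (K : M.Elem) : Convex ℝ (M.cell K) := convex_convexHull ℝ _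

theorem nonempty_inter_interior_cell {K : M.Elem} {x : Space d} (hx : x ∈ M.cell K)
    {B : Set (Space d)} (hB : IsOpen B) (hxB : x ∈ B) : (B ∩ interior (M.cell K)).Nonempty := by
  have h := (M.convex_cell K).closure_interior_eq_closure_of_nonempty_interior
    (M.interior_cell_nonempty K)
  have hx' : x ∈ closure (interior (M.cell K)) := h ▸ subset_closure hx
  exact mem_closure_iff.1 hx' B hB hxB

theorem interior_cell_subset (hΩ : interior (closure Ω) = Ω) (K : M.Elem) :
    interior (M.cell K) ⊆ Ω := by
  refine (interior_mono ?_).trans hΩ.subset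
  rw [M.closure_eq_iUnion_cell]
  exact Set.subset_iUnion _ K

/-- Two elements that meet outside the faces of codimension two share a facet. -/
theorem exists_facet_of_mem_cell {K L : M.Elem} (hKL : K ≠ L) {y : Space d} (hK : y ∈ M.cell K)
    (hL : y ∈ M.cell L)
    (hy : ∀ s ∈ M.complex.faces, s.card < d → y ∉ affineSpan ℝ (s : Set (Space d))) :
    ∃ e : M.Facet, e.1 ⊆ K.1 ∧ e.1 ⊆ L.1 := by
  classical
  -- Conformity: the two elements meet only in the hull of their common vertices, of which there are
  -- at most `d`. Fewer than `d` is excluded by `hy`.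
  have hmem : y ∈ convexHull ℝ ((K.1 ∩ L.1 : Finset (Space d)) : Set (Space d)) := by
    rw [Finset.coe_inter]
    exact M.complex.inter_subset_convexHull K.2.1 L.2.1 ⟨hK, hL⟩
  have hne : (K.1 ∩ L.1).Nonempty := by
    rw [← Finset.coe_nonempty, ← convexHull_nonempty_iff (𝕜 := ℝ)]
    exact ⟨y, hmem⟩
  have hface : K.1 ∩ L.1 ∈ M.complex.faces :=
    M.complex.down_closed K.2.1 Finset.inter_subset_left hne
  have hle : (K.1 ∩ L.1).card ≤ d := by
    by_contra! hlt
    have h1 : K.1 ∩ L.1 = K.1 := Finset.eq_of_subset_of_card_le Finset.inter_subset_left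
      (by rw [K.2.2]; omega)
    have h2 : K.1 ∩ L.1 = L.1 := Finset.eq_of_subset_of_card_le Finset.inter_subset_right
      (by rw [L.2.2]; omega)
    exact hKL (Subtype.ext (h1.symm.trans h2))
  rcases hle.lt_or_eq with hlt | heq
  · exact absurd (convexHull_subset_affineSpan _ hmem) (hy _ hface hlt)
  · exact ⟨⟨_, hface, heq⟩, Finset.inter_subset_left, Finset.inter_subset_right⟩

/-- The dual graph is connected. Otherwise the elements in `S` and those outside give two closed
sets covering `Ω`, which meet at some `x` in `Ω`. Near `x`, a generic segment from an element of `S`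
to one outside avoids all faces of codimension at least two, yet contains a point common to both
sets. The two elements meeting there share a facet, a contradiction. -/
theorem eq_univ_of_adjacent_mem (hopen : IsOpen Ω) (hconn : IsConnected Ω)
    (hΩ : interior (closure Ω) = Ω) {S : Set M.Elem} (hS : S.Nonempty)
    (hadj : ∀ K ∈ S, ∀ L, ∀ e : M.Facet, e.1 ⊆ K.1 → e.1 ⊆ L.1 → L ∈ S) : S = Set.univ := by
  classical
  by_contra hne
  obtain ⟨L₀, hL₀⟩ := (Set.ne_univ_iff_exists_notMem S).1 hne
  obtain ⟨K₀, hK₀⟩ := hS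
  set U := ⋃ K ∈ S, M.cell K with hU
  set W := ⋃ K ∈ Sᶜ, M.cell K with hW
  have hUc : IsClosed U := S.toFinite.isClosed_biUnion fun K _ => (M.isCompact_cell K).isClosed
  have hWc : IsClosed W := Sᶜ.toFinite.isClosed_biUnion fun K _ => (M.isCompact_cell K).isClosed
  have hcov : Ω ⊆ U ∪ W := by
    intro x hx
    have := subset_closure hx
    rw [M.closure_eq_iUnion_cell, Set.mem_iUnion] at this
    obtain ⟨K, hK⟩ := this
    by_cases h : K ∈ S
    · exact Or.inl (Set.mem_biUnion h hK)
    · exact Or.inr (Set.mem_biUnion (show K ∈ Sᶜ from h) hK)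
  have hmeet : ∀ K : M.Elem, ∃ x ∈ Ω, x ∈ M.cell K := fun K => by
    obtain ⟨x, hx⟩ := M.interior_cell_nonempty K
    exact ⟨x, M.interior_cell_subset hΩ K hx, interior_subset hx⟩
  obtain ⟨k, hkΩ, hk⟩ := hmeet K₀
  obtain ⟨l, hlΩ, hl⟩ := hmeet L₀
  obtain ⟨x, hxΩ, hxU, hxW⟩ := isPreconnected_closed_iff.1 hconn.isPreconnected U W hUc hWc hcov
    ⟨k, hkΩ, Set.mem_biUnion hK₀ hk⟩ ⟨l, hlΩ, Set.mem_biUnion (show L₀ ∈ Sᶜ from hL₀) hl⟩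
  obtain ⟨r, hr, hball⟩ := Metric.isOpen_iff.1 hopen x hxΩ
  simp only [hU, hW, Set.mem_iUnion, exists_prop] at hxU hxW
  obtain ⟨K, hKS, hxK⟩ := hxU
  obtain ⟨L, hLS, hxL⟩ := hxW
  set F := {s : Finset (Space d) | s ∈ M.complex.faces ∧ s.card < d} with hF
  have hFfin : F.Finite := M.finite.subset fun s hs => hs.1
  obtain ⟨a, ⟨haB, haK⟩, ha⟩ := exists_mem_notMem_affineSpan
    (Metric.isOpen_ball.inter isOpen_interior)
    (M.nonempty_inter_interior_cell hxK Metric.isOpen_ball (Metric.mem_ball_self hr))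
    hFfin (fun s hs => hs.2.le)
  -- `b` avoids the span of `a` together with any `s` of fewer than `d` vertices; this is still a
  -- span of at most `d` points.
  obtain ⟨b, ⟨hbB, hbL⟩, hb⟩ := exists_mem_notMem_affineSpan
    (Metric.isOpen_ball.inter isOpen_interior)
    (M.nonempty_inter_interior_cell hxL Metric.isOpen_ball (Metric.mem_ball_self hr))
    (hFfin.image (insert a)) (by
      rintro _ ⟨s, hs, rfl⟩
      exact (Finset.card_insert_le _ _).trans hs.2)
  have hseg : segment ℝ a b ⊆ U ∪ W :=
    ((convex_ball x r).segment_subset haB hbB).trans (hball.trans hcov)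
  obtain ⟨y, hyab, hyU, hyW⟩ := isPreconnected_closed_iff.1 (convex_segment a b).isPreconnected
    U W hUc hWc hseg ⟨a, left_mem_segment ℝ a b, Set.mem_biUnion hKS (interior_subset haK)⟩
    ⟨b, right_mem_segment ℝ a b, Set.mem_biUnion hLS (interior_subset hbL)⟩
  simp only [hU, hW, Set.mem_iUnion, exists_prop] at hyU hyW
  obtain ⟨K', hKS', hyK⟩ := hyU
  obtain ⟨L', hLS', hyL⟩ := hyW
  obtain ⟨e, he1, he2⟩ := M.exists_facet_of_mem_cell (K := K') (L := L')
    (by rintro rfl; exact hLS' hKS') hyK hyL (by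
    intro s hs hcard hys
    refine hb _ ⟨s, ⟨hs, hcard⟩, rfl⟩ ?_
    rw [segment_eq_image_lineMap] at hyab
    obtain ⟨t, -, rfl⟩ := hyab
    have ht : t ≠ 0 := by
      rintro rfl
      rw [AffineMap.lineMap_apply_zero] at hys
      exact ha s ⟨hs, hcard⟩ hys
    -- If a point of the segment other than `a` were in the span of `s`, then `b` would lie on the
    -- line through it and `a`, hence in the span of `a` and `s`.
    have hb' : b = AffineMap.lineMap a (AffineMap.lineMap a b t) t⁻¹ := by
      simp [AffineMap.lineMap_apply, smul_smul, inv_mul_cancel₀ ht]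
    rw [hb', Finset.coe_insert]
    exact AffineMap.lineMap_mem _
      (subset_affineSpan ℝ _ (Set.mem_insert _ _))
      (affineSpan_mono ℝ (Set.subset_insert _ _) hys))
  exact hLS' (hadj K' hKS' L' e he1 he2)

/-! ### The two sides of a facet -/

theorem minus_spec {e : M.Facet} (h : M.IsInterior e) :
    M.minus e ≠ M.plus e ∧ e.1 ⊆ (M.minus e).1 := by
  rw [minus, dif_pos h]
  exact h.choose_spec

open Classical in
/-- The sign of the trace from the element `K` in the jump on the facet `e`. -/
noncomputable def side (K : M.Elem) (e : M.Facet) : ℝ :=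
  if K = M.plus e then 1 else if M.IsInterior e ∧ K = M.minus e then -1 else 0

theorem side_plus (e : M.Facet) : M.side (M.plus e) e = 1 := by simp [side]

theorem side_minus {e : M.Facet} (h : M.IsInterior e) : M.side (M.minus e) e = -1 := by
  simp [side, h, (M.minus_spec h).1]

theorem side_of_not_subset {K : M.Elem} {e : M.Facet} (h : ¬ e.1 ⊆ K.1) : M.side K e = 0 := by
  have h1 : K ≠ M.plus e := fun h' => h (h' ▸ M.plus_spec e)
  have h2 : ¬ (M.IsInterior e ∧ K = M.minus e) := fun ⟨hi, h'⟩ => h (h' ▸ (M.minus_spec hi).2)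
  simp [side, h1, h2]

/-- Removes the case distinction from the jump: it is linear in the traces, and sums over facets and
elements can be exchanged. -/
theorem jump_eq_sum {X : Type} [AddCommGroup X] [Module ℝ X] (g : M.Elem → Space d → X)
    (e : M.Facet) (x : Space d) : M.jump g e x = ∑ K, M.side K e • g K x := by
  classical
  have hs : ∀ K, M.side K e • g K x = (if K = M.plus e then g K x else 0) +
      if K = M.minus e then (if M.IsInterior e then -g K x else 0) else 0 := by
    intro K
    by_cases h1 : K = M.plus e
    · by_cases hi : M.IsInterior e
      · have := (M.minus_spec hi).1
        subst h1
        simp [side, this.symm]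
      · simp [side, hi, h1]
    · by_cases h2 : K = M.minus e
      · subst h2
        by_cases hi : M.IsInterior e <;> simp [side, h1, hi]
      · simp [side, h1, h2]
  rw [Finset.sum_congr rfl fun K _ => hs K, Finset.sum_add_distrib]
  simp only [Finset.sum_ite_eq', Finset.mem_univ, if_true, jump]
  split_ifs <;> simp [sub_eq_add_neg]

section NeZero

variable [NeZero d]

theorem coord_oppFacet {K : M.Elem} {z : K.1} {y : Space d} (hy : y ∈ M.face (M.oppFacet K z)) :
    (M.basis K).coord z y = 0 := by
  obtain ⟨n, hn⟩ := M.exists_isOuterNormal_oppFacet K z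
  obtain ⟨w, hw⟩ := M.facet_nonempty (M.oppFacet K z)
  have h := hn.inner_eq_mul_coord hw y
  rw [inner_sub_right, hn.inner_face hy hw, sub_self] at h
  exact (mul_eq_zero.1 h.symm).resolve_left (hn.inner_pos hw).ne'

theorem mem_face_oppFacet_iff {K : M.Elem} {z : K.1} {y : Space d} :
    y ∈ M.face (M.oppFacet K z) ↔ y ∈ M.cell K ∧ (M.basis K).coord z y = 0 := by
  refine ⟨fun hy => ⟨?_, M.coord_oppFacet hy⟩, fun ⟨hy, h0⟩ => ?_⟩
  · exact convexHull_mono (Finset.coe_subset.2 (M.oppFacet_subset K z)) hy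
  · rw [M.cell_eq_convexJoin K z, mem_convexJoin] at hy
    simp only [Set.mem_singleton_iff, exists_eq_left] at hy
    obtain ⟨w, hw, hy⟩ := hy
    rw [segment_eq_image_lineMap] at hy
    obtain ⟨t, -, rfl⟩ := hy
    rw [AffineMap.apply_lineMap, M.coord_self, M.coord_oppFacet hw] at h0
    simp only [AffineMap.lineMap_apply, vsub_eq_sub, vadd_eq_add, smul_eq_mul] at h0
    have : t = 1 := by linarith
    rwa [this, AffineMap.lineMap_apply_one]

/-- A point in the relative interior of a facet. -/
theorem exists_mem_face_coord_pos (K : M.Elem) (z : K.1) :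
    ∃ c ∈ M.face (M.oppFacet K z), ∀ w, w ≠ z → 0 < (M.basis K).coord w c := by
  classical
  have hcard : ((Finset.univ : Finset K.1).erase z).card = d := by
    rw [Finset.card_erase_of_mem (Finset.mem_univ _), Finset.card_univ, Fintype.card_coe, K.2.2]
    simp
  have hd : 0 < d := Nat.pos_of_ne_zero (NeZero.ne d)
  have hpos : ∀ w, w ≠ z →
      0 < (M.basis K).coord w ((Finset.univ.erase z).centroid ℝ (M.basis K)) := fun w hw => by
    rw [(M.basis K).coord_apply_centroid (Finset.mem_erase.2 ⟨hw, Finset.mem_univ _⟩), hcard]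
    positivity
  have hz : (M.basis K).coord z ((Finset.univ.erase z).centroid ℝ (M.basis K)) = 0 := by
    rw [Finset.centroid_def]
    refine (M.basis K).coord_apply_combination_of_notMem (Finset.notMem_erase _ _) ?_
    exact Finset.sum_centroidWeights_eq_one_of_card_ne_zero ℝ _ (by rw [hcard]; exact hd.ne')
  refine ⟨_, M.mem_face_oppFacet_iff.2 ⟨(M.mem_cell_iff K _).2 fun w => ?_, hz⟩, hpos⟩
  by_cases hw : w = z
  · rw [hw, hz]
  · exact (hpos w hw).le

variable {M}

/-- Two elements that share a facet lie on opposite sides of it. -/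
theorem IsOuterNormal.neg {K L : M.Elem} {e : M.Facet} {n : Space d} (hn : M.IsOuterNormal K e n)
    (hK : e.1 ⊆ K.1) (hL : e.1 ⊆ L.1) (hKL : K ≠ L) : M.IsOuterNormal L e (-n) := by
  classical
  obtain ⟨z, rfl⟩ := M.exists_eq_oppFacet hK
  obtain ⟨z', hz'⟩ := M.exists_eq_oppFacet hL
  suffices hneg : (M.basis K).coord z (z' : Space d) < 0 by
    refine ⟨by rw [norm_neg, hn.1], fun x hx y hy => by
      rw [inner_neg_left, hn.2.1 x hx y hy, neg_zero], fun x hx w hw hwe => ?_⟩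
    have hw' : w = z' := by
      by_contra h
      exact hwe (hz' ▸ M.mem_oppFacet.2 ⟨h, hw⟩)
    rw [hw', inner_neg_left, ← inner_neg_right, neg_sub, hn.inner_eq_mul_coord hx]
    exact mul_neg_of_pos_of_neg (hn.inner_pos hx) hneg
  -- If the apex `z'` of `L` were on the same side as `z`, a short move from the relative interior
  -- point `c` of the facet towards `z'` would stay in `K` and in `L`. By conformity it would stay
  -- in the common facet, although the coordinate of `z'` in `L` becomes `t > 0`.
  by_contra! hnonneg
  obtain ⟨c, hc, hpos⟩ := M.exists_mem_face_coord_pos K z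
  have hcont : ∀ w, Continuous fun t : ℝ =>
      (M.basis K).coord w (AffineMap.lineMap c (z' : Space d) t) := fun w =>
    (continuous_barycentric_coord (M.basis K) w).comp AffineMap.lineMap_continuous
  have hev : ∀ᶠ t : ℝ in 𝓝[>] 0, ∀ w,
      0 ≤ (M.basis K).coord w (AffineMap.lineMap c (z' : Space d) t) := by
    rw [eventually_all]
    intro w
    by_cases hw : w = z
    · filter_upwards [self_mem_nhdsWithin] with t ht
      rw [hw, AffineMap.apply_lineMap, M.coord_oppFacet hc]
      simp only [AffineMap.lineMap_apply, vsub_eq_sub, vadd_eq_add, smul_eq_mul, sub_zero, add_zero]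
      exact mul_nonneg (le_of_lt ht) hnonneg
    · refine nhdsWithin_le_nhds (((hcont w).tendsto 0).eventually ?_)
      rw [AffineMap.lineMap_apply_zero]
      filter_upwards [lt_mem_nhds (hpos w hw)] with s hs using hs.le
  obtain ⟨t, ⟨ht, ht0⟩, ht1⟩ := ((hev.and self_mem_nhdsWithin).and
    (nhdsWithin_le_nhds (gt_mem_nhds (zero_lt_one (α := ℝ))))).exists
  have ht0 : 0 < t := ht0
  have hcL : c ∈ M.cell L := by
    rw [hz'] at hc
    exact (M.mem_face_oppFacet_iff.1 hc).1
  have hpL : AffineMap.lineMap c (z' : Space d) t ∈ M.cell L := by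
    refine (M.convex_cell L).segment_subset hcL (subset_convexHull ℝ _ z'.2) ?_
    rw [segment_eq_image_lineMap]
    exact ⟨t, ⟨ht0.le, ht1.le⟩, rfl⟩
  -- If `z'` were also a vertex of `K`, then `K` would contain all vertices of `L` and equal it.
  have hinter : (K.1 ∩ L.1 : Set (Space d)) ⊆ (M.oppFacet L z').1 := by
    rintro y ⟨hyK, hyL⟩
    refine M.mem_oppFacet.2 ⟨?_, hyL⟩
    rintro rfl
    refine hKL (Subtype.ext (Finset.eq_of_subset_of_card_le (fun y hy => ?_)
      (by rw [K.2.2, L.2.2])).symm)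
    by_cases h : y = z'
    · exact h ▸ hyK
    · exact hK (hz' ▸ M.mem_oppFacet.2 ⟨h, hy⟩)
  have hp : AffineMap.lineMap c (z' : Space d) t ∈ M.face (M.oppFacet L z') :=
    convexHull_mono hinter
      (M.complex.inter_subset_convexHull K.2.1 L.2.1 ⟨(M.mem_cell_iff K _).2 ht, hpL⟩)
  have h0 := M.coord_oppFacet hp
  rw [AffineMap.apply_lineMap, M.coord_oppFacet (hz' ▸ hc), M.coord_self] at h0
  simp only [AffineMap.lineMap_apply, vsub_eq_sub, vadd_eq_add, smul_eq_mul, sub_zero, add_zero,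
    mul_one] at h0
  exact ht0.ne' h0

theorem IsOuterNormal.not_isOuterNormal_neg {K : M.Elem} {e : M.Facet} {n : Space d} (h : e.1 ⊆ K.1)
    (hn : M.IsOuterNormal K e n) : ¬ M.IsOuterNormal K e (-n) := by
  intro hn'
  obtain ⟨z, rfl⟩ := M.exists_eq_oppFacet h
  obtain ⟨y, hy⟩ := M.facet_nonempty (M.oppFacet K z)
  have h1 := hn.inner_pos hy
  have h2 := hn'.inner_pos hy
  rw [inner_neg_left] at h2
  linarith

variable (M)

/-- A third element at `e` would lie opposite to `K⁺` and also opposite to `K⁻`, so `-n_e` and `n_e`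
would both be outer normals of it. Thus the chosen `M.minus e` is the only possible one. -/
theorem eq_plus_or_minus {K : M.Elem} {e : M.Facet} (h : e.1 ⊆ K.1) :
    K = M.plus e ∨ (M.IsInterior e ∧ K = M.minus e) := by
  by_contra! hcon
  have hint : M.IsInterior e := ⟨K, hcon.1, h⟩
  obtain ⟨hne, hsub⟩ := M.minus_spec hint
  have h1 := (M.normal_spec e).neg (M.plus_spec e) hsub hne.symm
  have h2 := h1.neg hsub h (hcon.2 hint).symm
  exact h2.not_isOuterNormal_neg h ((by simpa using (M.normal_spec e).neg (M.plus_spec e) h hcon.1.symm))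

theorem isOuterNormal_side {K : M.Elem} {e : M.Facet} (h : e.1 ⊆ K.1) :
    M.IsOuterNormal K e (M.side K e • M.normal e) := by
  rcases M.eq_plus_or_minus h with rfl | ⟨hi, rfl⟩
  · rw [side_plus, one_smul]
    exact M.normal_spec e
  · rw [M.side_minus hi, neg_smul, one_smul]
    exact (M.normal_spec e).neg (M.plus_spec e) h (M.minus_spec hi).1.symm

theorem faceMeasure_mul_side_mul_inner {K : M.Elem} {z : K.1} {y : Space d}
    (hy : y ∈ M.face (M.oppFacet K z)) (x : Space d) :
    M.faceMeasure (M.oppFacet K z) *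
      (M.side K (M.oppFacet K z) * inner ℝ (M.normal (M.oppFacet K z)) (y - x)) =
      d * volume.real (M.cell K) * (M.basis K).coord z x := by
  rw [← real_inner_smul_left]
  exact (M.isOuterNormal_side (M.oppFacet_subset K z)).faceMeasure_mul_inner hy x

end NeZero

end Mesh

theorem affineMap_eqOn_convexHull {E F : Type*} [AddCommGroup E] [Module ℝ E] [AddCommGroup F]
    [Module ℝ F] {f g : E →ᵃ[ℝ] F} {s : Set E} (h : ∀ x ∈ s, f x = g x) {x : E}
    (hx : x ∈ convexHull ℝ s) : f x = g x := by
  have hconv : Convex ℝ {x : E | (f - g) x = 0} := (convex_singleton (𝕜 := ℝ) 0).affine_preimage _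
  have := convexHull_min (fun y hy => by simp [h y hy]) hconv hx
  exact sub_eq_zero.1 this

namespace Mesh

variable {d : ℕ} {Ω : Set (Space d)} (M : Mesh Ω)

/-! ### Integrals over facets -/

theorem faceIntegral_const (e : M.Facet) (c : ℝ) :
    M.faceIntegral e (fun _ => c) = M.faceMeasure e * c := by
  simp [faceIntegral, faceMeasure]

theorem faceIntegral_congr (e : M.Facet) {f g : Space d → ℝ} (h : ∀ x ∈ M.face e, f x = g x) :
    M.faceIntegral e f = M.faceIntegral e g :=
  setIntegral_congr_fun (M.isCompact_face e).measurableSet h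

section NeZero

variable [NeZero d]

theorem integrableOn_face (e : M.Facet) {f : Space d → ℝ} (hf : Continuous f) :
    IntegrableOn f (M.face e) (μHE[d - 1] : Measure (Space d)) := by
  obtain ⟨C, hC⟩ := (M.isCompact_face e).exists_bound_of_continuousOn hf.continuousOn
  refine IntegrableOn.of_bound (lt_top_iff_ne_top.2 (M.measure_face_ne_zero_and_ne_top e).2)
    hf.aestronglyMeasurable C ?_
  filter_upwards [ae_restrict_mem (M.isCompact_face e).measurableSet] with x hx using hC x hx

theorem faceIntegral_add (e : M.Facet) {f g : Space d → ℝ} (hf : Continuous f)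
    (hg : Continuous g) :
    M.faceIntegral e (fun x => f x + g x) = M.faceIntegral e f + M.faceIntegral e g :=
  integral_add (M.integrableOn_face e hf) (M.integrableOn_face e hg)

theorem faceIntegral_sub (e : M.Facet) {f g : Space d → ℝ} (hf : Continuous f)
    (hg : Continuous g) :
    M.faceIntegral e (fun x => f x - g x) = M.faceIntegral e f - M.faceIntegral e g :=
  integral_sub (M.integrableOn_face e hf) (M.integrableOn_face e hg)

/-- Shrinking the convex face towards `x` keeps it inside the face and, for a small enough ratio,
inside `U`; the shrunken copy has a positive multiple of the measure of the face. -/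
theorem measure_inter_face_pos (e : M.Facet) {U : Set (Space d)} (hU : IsOpen U) {x : Space d}
    (hxU : x ∈ U) (hx : x ∈ M.face e) : 0 < (μHE[d - 1] : Measure (Space d)) (U ∩ M.face e) := by
  obtain ⟨r, hr, hball⟩ := Metric.isOpen_iff.1 hU x hxU
  obtain ⟨R, hR⟩ := (Metric.isBounded_iff_subset_closedBall x).1 (M.isCompact_face e).isBounded
  have hR0 : 0 ≤ R := dist_nonneg.trans (Metric.mem_closedBall.1 (hR hx))
  have hc0 : 0 < r / (R + r) := by positivity
  have hsub : AffineMap.homothety x (r / (R + r)) '' M.face e ⊆ U ∩ M.face e := by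
    rintro _ ⟨y, hy, rfl⟩
    refine ⟨hball ?_, ?_⟩
    · have hyR : dist y x ≤ R := hR hy
      rw [Metric.mem_ball, dist_homothety_center, Real.norm_of_nonneg hc0.le, dist_comm x y]
      calc r / (R + r) * dist y x ≤ r / (R + r) * R := by gcongr
        _ < r := by rw [div_mul_eq_mul_div, div_lt_iff₀ (by positivity)]; nlinarith
    · refine (convex_convexHull ℝ _).segment_subset hx hy ?_
      rw [segment_eq_image_lineMap]
      refine ⟨r / (R + r), ⟨hc0.le, ?_⟩, rfl⟩
      rw [div_le_one (by positivity)]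
      linarith
  refine lt_of_lt_of_le ?_ (measure_mono hsub)
  rw [euclideanHausdorffMeasure_homothety_image _ _ hc0.ne', ENNReal.smul_def, smul_eq_mul]
  refine ENNReal.mul_pos ?_ (M.measure_face_ne_zero_and_ne_top e).1
  simp only [ne_eq, ENNReal.coe_eq_zero]
  exact pow_ne_zero _ (by simpa using hc0.ne')

theorem eq_zero_of_faceIntegral_eq_zero (e : M.Facet) {f : Space d → ℝ} (hf : Continuous f)
    (hnonneg : ∀ x, 0 ≤ f x) (h : M.faceIntegral e f = 0) {x : Space d} (hx : x ∈ M.face e) :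
    f x = 0 := by
  by_contra hne
  rw [faceIntegral, integral_eq_zero_iff_of_nonneg (fun x => hnonneg x) (M.integrableOn_face e hf)]
    at h
  have h0 : (μHE[d - 1] : Measure (Space d)) ({y | f y ≠ 0} ∩ M.face e) = 0 := by
    rw [← Measure.restrict_apply (isOpen_ne_fun hf continuous_const).measurableSet]
    exact ae_iff.1 h
  exact (M.measure_inter_face_pos e (isOpen_ne_fun hf continuous_const) hne hx).ne' h0

/-- The choice `p = a - b` makes the integral of `(a - b) ^ 2` over the facet vanish. -/
theorem eqOn_face_of_moments (e : M.Facet) {a b : Space d →ᵃ[ℝ] ℝ}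
    (h : ∀ p : Space d →ᵃ[ℝ] ℝ,
      M.faceIntegral e (fun x => a x * p x) = M.faceIntegral e (fun x => b x * p x))
    {x : Space d} (hx : x ∈ M.face e) : a x = b x := by
  have ha : Continuous a := a.continuous_of_finiteDimensional
  have hb : Continuous b := b.continuous_of_finiteDimensional
  have hint : M.faceIntegral e (fun x => (a x - b x) ^ 2) = 0 := by
    have h1 := sub_eq_zero.2 (h (a - b))
    have hab : Continuous (a - b : Space d →ᵃ[ℝ] ℝ) :=
      (a - b : Space d →ᵃ[ℝ] ℝ).continuous_of_finiteDimensional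
    rw [← M.faceIntegral_sub e (by fun_prop) (by fun_prop)] at h1
    rw [← h1]
    refine M.faceIntegral_congr e fun x _ => ?_
    simp only [AffineMap.coe_sub, Pi.sub_apply]
    ring
  have := M.eq_zero_of_faceIntegral_eq_zero e (by fun_prop) (fun x => sq_nonneg _) hint hx
  exact sub_eq_zero.1 (pow_eq_zero_iff two_ne_zero |>.1 this)

end NeZero

/-! ### The velocity reconstruction -/

/-- The component of an affine field in the direction `n`. -/
noncomputable def component (n : Space d) (w : Space d →ᵃ[ℝ] Space d) : Space d →ᵃ[ℝ] ℝ :=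
  (innerₛₗ ℝ n).toAffineMap.comp w

theorem component_apply (n : Space d) (w : Space d →ᵃ[ℝ] Space d) (x : Space d) :
    component n w x = inner ℝ (w x) n := by
  rw [real_inner_comm]
  rfl

open Classical in
/-- The normal component on the facet `e` prescribed by the degrees of freedom of `ℛv`. -/
noncomputable def normalTrace (v : M.BrokenP1) (e : M.Facet) : Space d →ᵃ[ℝ] ℝ :=
  if M.IsInterior e then component (M.normal e) ((1 / 2 : ℝ) • (v (M.plus e) + v (M.minus e))) else 0

theorem normalTrace_of_interior (v : M.BrokenP1) {e : M.Facet} (h : M.IsInterior e) (x : Space d) :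
    M.normalTrace v e x = inner ℝ (M.avg (fun K => v K) e x) (M.normal e) := by
  rw [normalTrace, if_pos h, component_apply, avg, if_pos h]
  rfl

theorem normalTrace_add (v w : M.BrokenP1) (e : M.Facet) (x : Space d) :
    M.normalTrace (v + w) e x = M.normalTrace v e x + M.normalTrace w e x := by
  by_cases h : M.IsInterior e
  · simp only [normalTrace, if_pos h, component_apply, ← inner_add_left]
    congr 1
    simp only [Pi.add_apply, AffineMap.coe_smul, AffineMap.coe_add, Pi.smul_apply]
    module
  · simp [normalTrace, h]

theorem normalTrace_smul (c : ℝ) (v : M.BrokenP1) (e : M.Facet) (x : Space d) :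
    M.normalTrace (c • v) e x = c * M.normalTrace v e x := by
  by_cases h : M.IsInterior e
  · simp only [normalTrace, if_pos h, component_apply, ← real_inner_smul_left]
    congr 1
    simp only [Pi.add_apply, AffineMap.coe_smul, AffineMap.coe_add, Pi.smul_apply]
    module
  · simp [normalTrace, h]

section NeZero

variable [NeZero d]

/-- Affine functions on a facet are determined by their first moments, and also by their values at
the vertices. The moment conditions and the normal continuity thus become prescribed values at
vertices, separately for each element. -/
theorem isReconstruction_iff (v r : M.BrokenP1) : M.IsReconstruction v r ↔
    ∀ (K : M.Elem) (e : M.Facet), e.1 ⊆ K.1 → ∀ x ∈ e.1,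
      inner ℝ (r K x) (M.normal e) = M.normalTrace v e x := by
  simp only [← component_apply]
  constructor
  · rintro ⟨hbdm, hint, hbd⟩ K e he x hx
    have hxe : x ∈ M.face e := subset_convexHull ℝ _ hx
    have hplus : component (M.normal e) (r (M.plus e)) x = M.normalTrace v e x := by
      refine M.eqOn_face_of_moments e (fun p => ?_) hxe
      by_cases h : M.IsInterior e
      · simp only [component_apply, M.normalTrace_of_interior v h]
        exact hint e h p
      · simp only [component_apply, normalTrace, if_neg h, hbd e h p]
        simp [faceIntegral]
    rcases M.eq_plus_or_minus he with rfl | ⟨hi, rfl⟩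
    · exact hplus
    · rw [← hplus, component_apply, component_apply]
      exact (hbdm e hi x hxe).symm
  · intro h
    have hface : ∀ (K : M.Elem) (e : M.Facet), e.1 ⊆ K.1 → ∀ x ∈ M.face e,
        component (M.normal e) (r K) x = M.normalTrace v e x :=
      fun K e he x hx => affineMap_eqOn_convexHull (fun y hy => h K e he y hy) hx
    refine ⟨fun e he x hx => ?_, fun e he p => ?_, fun e he p => ?_⟩
    · rw [← component_apply, ← component_apply, hface _ e (M.plus_spec e) x hx,
        hface _ e (M.minus_spec he).2 x hx]
    · refine M.faceIntegral_congr e fun x hx => ?_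
      rw [← component_apply, hface _ e (M.plus_spec e) x hx, M.normalTrace_of_interior v he]
    · rw [M.faceIntegral_congr e (g := fun _ => 0) fun x hx => ?_, faceIntegral_const, mul_zero]
      rw [← component_apply, hface _ e (M.plus_spec e) x hx, normalTrace, if_neg he]
      simp

/-- Together with `inner_normal_oppFacet_ne_zero`: for a fixed vertex `y`, the edge vectors `w - y`
and the normals of the facets opposite to `w` are biorthogonal up to nonzero factors. -/
theorem inner_normal_oppFacet_eq_zero (K : M.Elem) {w x y : K.1} (hx : x ≠ w) (hy : y ≠ w) :
    inner ℝ ((x : Space d) - y) (M.normal (M.oppFacet K w)) = 0 := by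
  rw [real_inner_comm]
  exact (M.normal_spec _).2.1 _ (M.mem_oppFacet.2 ⟨fun h => hx (Subtype.ext h), x.2⟩) _
    (M.mem_oppFacet.2 ⟨fun h => hy (Subtype.ext h), y.2⟩)

theorem inner_normal_oppFacet_ne_zero (K : M.Elem) {w y : K.1} (hy : y ≠ w) :
    inner ℝ ((w : Space d) - y) (M.normal (M.oppFacet K w)) ≠ 0 := by
  have h := (M.isOuterNormal_side (M.oppFacet_subset K w)).inner_pos
    (M.mem_oppFacet.2 ⟨fun h => hy (Subtype.ext h), y.2⟩)
  rw [real_inner_smul_left] at h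
  intro h0
  rw [← neg_sub, inner_neg_left, real_inner_comm] at h0
  rw [neg_eq_zero.1 h0, mul_zero] at h
  exact lt_irrefl _ h

/-- A vector is determined by its components along the normals of the facets at a vertex. -/
theorem eq_of_inner_normal_eq (K : M.Elem) (z : K.1) {a b : Space d}
    (h : ∀ w : K.1, w ≠ z → inner ℝ a (M.normal (M.oppFacet K w)) =
      inner ℝ b (M.normal (M.oppFacet K w))) : a = b := by
  classical
  -- Translating `z` by `a - b` leaves every coordinate other than that of `z` equal to 0, so the
  -- translated point is `z` itself.
  have hcoord : ∀ w : K.1, w ≠ z → (M.basis K).coord w ((z : Space d) + (a - b)) = 0 := by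
    intro w hw
    have hz : (z : Space d) ∈ (M.oppFacet K w).1 :=
      M.mem_oppFacet.2 ⟨fun h => hw (Subtype.ext h.symm), z.2⟩
    have hn := M.isOuterNormal_side (M.oppFacet_subset K w)
    have h1 := hn.inner_eq_mul_coord hz ((z : Space d) + (a - b))
    rw [sub_add_cancel_left, inner_neg_right, real_inner_smul_left, real_inner_comm, inner_sub_left,
      h w hw, sub_self, mul_zero, neg_zero] at h1
    exact (mul_eq_zero.1 h1.symm).resolve_left (hn.inner_pos hz).ne'
  have hz1 : (M.basis K).coord z ((z : Space d) + (a - b)) = 1 := by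
    have := (M.basis K).sum_coord_apply_eq_one ((z : Space d) + (a - b))
    rwa [Finset.sum_eq_single z (fun w _ hw => hcoord w hw) (by simp)] at this
  have : (z : Space d) + (a - b) = z := by
    refine (M.basis K).ext_elem fun w => ?_
    by_cases hw : w = z
    · rw [hw, hz1, M.coord_self]
    · rw [hcoord w hw, M.coord_of_ne K hw]
  rwa [add_eq_left, sub_eq_zero] at this

/-- The conditions decouple into one `d × d` system for each vertex `z` of each element.
Biorthogonality of edges and normals diagonalises it: the coefficient of `w - z` is the prescribed
normal value divided by the normal component of `w - z`. -/
theorem existsUnique_isReconstruction (v : M.BrokenP1) : ∃! r, M.IsReconstruction v r := by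
  classical
  have hex : ∀ K : M.Elem, ∃ r : Space d →ᵃ[ℝ] Space d, ∀ z : K.1, r z =
      ∑ w ∈ Finset.univ.erase z, (M.normalTrace v (M.oppFacet K w) z /
        inner ℝ ((w : Space d) - z) (M.normal (M.oppFacet K w))) • ((w : Space d) - z) :=
    fun K => exists_affineMap_basis (M.basis K) _
  choose r hr using hex
  refine ⟨r, (M.isReconstruction_iff v r).2 fun K e he x hx => ?_, fun r' hr' => ?_⟩
  · obtain ⟨w, rfl⟩ := M.exists_eq_oppFacet he
    obtain ⟨hxw, hxK⟩ := M.mem_oppFacet.1 hx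
    have hne : (⟨x, hxK⟩ : K.1) ≠ w := fun h => hxw (by rw [← h])
    have hrx := hr K ⟨x, hxK⟩
    simp only at hrx
    rw [hrx, sum_inner, Finset.sum_eq_single_of_mem w
      (Finset.mem_erase.2 ⟨hne.symm, Finset.mem_univ _⟩), real_inner_smul_left]
    · exact div_mul_cancel₀ _ (M.inner_normal_oppFacet_ne_zero K hne)
    · intro y _ hy
      rw [real_inner_smul_left, M.inner_normal_oppFacet_eq_zero K (y := ⟨x, hxK⟩) hy hne, mul_zero]
  · replace hr' := (M.isReconstruction_iff v r').1 hr'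
    funext K
    refine affineMap_ext_basis (M.basis K) fun z => ?_
    refine M.eq_of_inner_normal_eq K z fun w hw => ?_
    rw [basis_apply, hr' K _ (M.oppFacet_subset K w) z
      (M.mem_oppFacet.2 ⟨fun h => hw (Subtype.ext h.symm), z.2⟩), hr, sum_inner,
      Finset.sum_eq_single_of_mem w (Finset.mem_erase.2 ⟨hw, Finset.mem_univ _⟩),
      real_inner_smul_left]
    · exact (div_mul_cancel₀ _ (M.inner_normal_oppFacet_ne_zero K hw.symm)).symm
    · intro y _ hy
      rw [real_inner_smul_left, M.inner_normal_oppFacet_eq_zero K hy hw.symm, mul_zero]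

theorem reconstruct_spec (v : M.BrokenP1) : M.IsReconstruction v (M.reconstruct v) :=
  Classical.epsilon_spec (M.existsUnique_isReconstruction v).exists

theorem reconstruct_eq {v r : M.BrokenP1} (h : M.IsReconstruction v r) : M.reconstruct v = r :=
  (M.existsUnique_isReconstruction v).unique (M.reconstruct_spec v) h

theorem reconstruct_add (v w : M.BrokenP1) :
    M.reconstruct (v + w) = M.reconstruct v + M.reconstruct w := by
  refine M.reconstruct_eq ((M.isReconstruction_iff _ _).2 fun K e he x hx => ?_)
  rw [M.normalTrace_add, ← (M.isReconstruction_iff _ _).1 (M.reconstruct_spec v) K e he x hx,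
    ← (M.isReconstruction_iff _ _).1 (M.reconstruct_spec w) K e he x hx, ← inner_add_left]
  rfl

theorem reconstruct_smul (c : ℝ) (v : M.BrokenP1) :
    M.reconstruct (c • v) = c • M.reconstruct v := by
  refine M.reconstruct_eq ((M.isReconstruction_iff _ _).2 fun K e he x hx => ?_)
  rw [M.normalTrace_smul, ← (M.isReconstruction_iff _ _).1 (M.reconstruct_spec v) K e he x hx,
    ← real_inner_smul_left]
  rfl

end NeZero

/-! ### The load -/

theorem aestronglyMeasurable_field (r : M.BrokenP1) (μ : Measure (Space d)) :
    AEStronglyMeasurable (M.field r) μ := by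
  classical
  refine Measurable.aestronglyMeasurable ?_
  unfold field glue
  refine Finset.measurable_sum _ fun K _ => ?_
  exact Measurable.ite isOpen_interior.measurableSet
    (r K).continuous_of_finiteDimensional.measurable measurable_const

theorem exists_norm_field_le (r : M.BrokenP1) : ∃ C, ∀ x, ‖M.field r x‖ ≤ C := by
  classical
  have h : ∀ K : M.Elem, ∃ C, ∀ x ∈ M.cell K, ‖r K x‖ ≤ C := fun K =>
    (M.isCompact_cell K).exists_bound_of_continuousOn
      (r K).continuous_of_finiteDimensional.continuousOn
  choose C hC using h
  refine ⟨∑ K, |C K|, fun x => (norm_sum_le _ _).trans (Finset.sum_le_sum fun K _ => ?_)⟩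
  split_ifs with hx
  · exact (hC K x (interior_subset hx)).trans (le_abs_self _)
  · simp

theorem integrable_inner_field (hb : Bornology.IsBounded Ω) {f : Space d → Space d}
    (hf : MemLp f 2 (volume.restrict Ω)) (r : M.BrokenP1) :
    Integrable (fun x => inner ℝ (f x) (M.field r x)) (volume.restrict Ω) := by
  have : IsFiniteMeasure (volume.restrict Ω) := isFiniteMeasure_restrict.2 hb.measure_lt_top.ne
  obtain ⟨C, hC⟩ := M.exists_norm_field_le r
  refine ((hf.integrable one_le_two).norm.mul_const C).mono'
    (hf.1.inner (M.aestronglyMeasurable_field r _)) (ae_of_all _ fun x => ?_)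
  refine (norm_inner_le_norm _ _).trans ?_
  gcongr
  exact hC x

theorem load_add [NeZero d] (hb : Bornology.IsBounded Ω) {f : Space d → Space d}
    (hf : MemLp f 2 (volume.restrict Ω)) (v w : M.BrokenP1) :
    M.load f (v + w) = M.load f v + M.load f w := by
  simp only [load, reconstruct_add, field_add, Pi.add_apply, inner_add_right]
  exact integral_add (M.integrable_inner_field hb hf _) (M.integrable_inner_field hb hf _)

theorem load_smul [NeZero d] (f : Space d → Space d) (c : ℝ) (v : M.BrokenP1) :
    M.load f (c • v) = c * M.load f v := by
  simp only [load, reconstruct_smul, field_smul, Pi.smul_apply, inner_smul_right]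
  exact integral_const_mul _ _

/-! ### The divergence form -/

theorem continuous_component (n : Space d) (w : Space d →ᵃ[ℝ] Space d) :
    Continuous (component n w) :=
  (component n w).continuous_of_finiteDimensional

/-- The affine field `x ↦ x - a`. -/
noncomputable def radial (a : Space d) : Space d →ᵃ[ℝ] Space d :=
  AffineMap.id ℝ (Space d) - AffineMap.const ℝ (Space d) a

theorem radial_apply (a x : Space d) : radial a x = x - a := rfl

theorem trace_radial (a : Space d) : LinearMap.trace ℝ (Space d) (radial a).linear = d := by
  have : (radial a).linear = LinearMap.id := by
    ext1 x
    simp [radial]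
  rw [this, LinearMap.trace_id, finrank_euclideanSpace_fin]

theorem coord_centroid (K : M.Elem) (z : K.1) :
    (M.basis K).coord z (M.centroid K) = 1 / (d + 1) := by
  have h : M.centroid K = Finset.univ.centroid ℝ (M.basis K) := (Finset.centroid_univ ℝ K.1).symm
  rw [h, (M.basis K).coord_apply_centroid (Finset.mem_univ z), Finset.card_univ, Fintype.card_coe,
    K.2.2]
  simp

open Classical in
/-- The basis function of `D_h` supported in `K`. -/
noncomputable def enrichment (K : M.Elem) : M.BrokenP1 := Pi.single K (radial (M.centroid K))

theorem enrichment_mem_velocity (K : M.Elem) : M.enrichment K ∈ M.velocity := by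
  classical
  refine Submodule.mem_sup_right ⟨Pi.single K 1, fun L x => ?_⟩
  by_cases h : L = K
  · subst h
    simp [enrichment, radial_apply]
  · simp [enrichment, h]

theorem nonempty_elem (hconn : IsConnected Ω) : Nonempty M.Elem := by
  obtain ⟨x, hx⟩ := hconn.nonempty
  have := subset_closure hx
  rw [M.closure_eq_iUnion_cell, Set.mem_iUnion] at this
  exact ⟨this.choose⟩

open Classical in
/-- The average of a piecewise constant function on a facet. -/
noncomputable def avgConst (e : M.Facet) : M.BrokenP0 →ₗ[ℝ] ℝ :=
  if M.IsInterior e then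
    (1 / 2 : ℝ) • ((LinearMap.proj (M.plus e) : M.BrokenP0 →ₗ[ℝ] ℝ) + LinearMap.proj (M.minus e))
  else LinearMap.proj (M.plus e)

theorem avg_const_eq (q : M.BrokenP0) (e : M.Facet) (x : Space d) :
    M.avg (fun K _ => q K) e x = M.avgConst e q := by
  by_cases h : M.IsInterior e <;> simp [avg, avgConst, h, mul_add]

theorem avgConst_of_interior {e : M.Facet} (h : M.IsInterior e) (q : M.BrokenP0) :
    M.avgConst e q = (q (M.plus e) + q (M.minus e)) / 2 := by
  simp [avgConst, h]
  ring

theorem avgConst_of_not_interior {e : M.Facet} (h : ¬ M.IsInterior e) (q : M.BrokenP0) :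
    M.avgConst e q = q (M.plus e) := by
  simp [avgConst, h]

section NeZero

variable [NeZero d]

/-- The flux of an affine field through a facet. -/
noncomputable def flux (e : M.Facet) : (Space d →ᵃ[ℝ] Space d) →ₗ[ℝ] ℝ where
  toFun w := M.faceIntegral e (component (M.normal e) w)
  map_add' v w := by
    rw [← M.faceIntegral_add e (continuous_component _ v) (continuous_component _ w)]
    refine M.faceIntegral_congr e fun x _ => ?_
    simp [component_apply, inner_add_left]
  map_smul' c v := by
    simp only [RingHom.id_apply, smul_eq_mul, faceIntegral, ← integral_const_mul]
    refine M.faceIntegral_congr e fun x _ => ?_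
    simp [component_apply, real_inner_smul_left]

/-- Divergences and pressures are constant on elements and averages are constant on facets, so only
volumes and fluxes remain; bilinearity can be read off. -/
theorem formB_eq (w : M.BrokenP1) (q : M.BrokenP0) : M.formB w q =
    ∑ K, volume.real (M.cell K) * (LinearMap.trace ℝ (Space d) (w K).linear * q K) -
      ∑ e, (∑ K, M.side K e * M.flux e (w K)) * M.avgConst e q := by
  have hflux : ∀ e, (∑ K, M.side K e * M.flux e (w K)) =
      M.faceIntegral e fun x => ∑ K, M.side K e * component (M.normal e) (w K) x := by
    intro e
    simp only [faceIntegral]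
    rw [integral_finsetSum _ fun K _ =>
      (M.integrableOn_face e (continuous_component _ (w K))).const_mul _]
    simp only [integral_const_mul]
    rfl
  rw [formB]
  congr 1
  · simp [Measure.real]
  · refine Finset.sum_congr rfl fun e _ => ?_
    simp only [avg_const_eq, hflux, faceIntegral, ← integral_mul_const]
    refine M.faceIntegral_congr e fun x _ => ?_
    simp only [jump_eq_sum, sum_inner, real_inner_smul_left, component_apply]

/-- The form `b` as a bilinear map. -/
noncomputable def bilinB : M.BrokenP1 →ₗ[ℝ] M.BrokenP0 →ₗ[ℝ] ℝ :=
  LinearMap.mk₂ ℝ M.formB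
    (fun v w q => by
      simp only [formB_eq, Pi.add_apply, AffineMap.add_linear, map_add, mul_add, add_mul,
        Finset.sum_add_distrib]
      ring)
    (fun c v q => by
      simp only [formB_eq, Pi.smul_apply, AffineMap.smul_linear, map_smul, smul_eq_mul, mul_sub,
        Finset.mul_sum, Finset.sum_mul]
      congr 1
      · exact Finset.sum_congr rfl fun K _ => by ring
      · exact Finset.sum_congr rfl fun e _ => Finset.sum_congr rfl fun K _ => by ring)
    (fun v p q => by
      simp only [formB_eq, Pi.add_apply, map_add, mul_add, Finset.sum_add_distrib]
      ring)
    (fun c v q => by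
      simp only [formB_eq, Pi.smul_apply, map_smul, smul_eq_mul, mul_sub, Finset.mul_sum]
      congr 1
      · exact Finset.sum_congr rfl fun K _ => by ring
      · exact Finset.sum_congr rfl fun e _ => by ring)

/-- The normal component of `x - a` is constant on a facet, so the outward flux is `d` times the
signed volume of the cone with apex `a`. -/
theorem side_mul_flux_radial (K : M.Elem) (z : K.1) (a : Space d) :
    M.side K (M.oppFacet K z) * M.flux (M.oppFacet K z) (radial a) =
      d * volume.real (M.cell K) * (M.basis K).coord z a := by
  obtain ⟨y, hy⟩ := M.facet_nonempty (M.oppFacet K z)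
  have hyf : y ∈ M.face (M.oppFacet K z) := subset_convexHull ℝ _ hy
  rw [← M.faceMeasure_mul_side_mul_inner hyf a]
  have : M.flux (M.oppFacet K z) (radial a) = M.faceMeasure (M.oppFacet K z) *
      inner ℝ (M.normal (M.oppFacet K z)) (y - a) := by
    rw [← M.faceIntegral_const]
    refine M.faceIntegral_congr _ fun x hx => ?_
    rw [component_apply, radial_apply, real_inner_comm, inner_sub_right, inner_sub_right,
      (M.normal_spec _).inner_face hx hy]
  rw [this]
  ring

/-- The divergence is `d` on `K`. Since all barycentric coordinates of the centroid are `1 / (d +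
1)`, the total outward flux `d |K|` is shared equally by the `d + 1` facets, which leaves a sum of
differences. -/
theorem formB_enrichment (K : M.Elem) (q : M.BrokenP0) : M.formB (M.enrichment K) q =
    d * volume.real (M.cell K) / (d + 1) * ∑ e ∈ M.facetsOf K, (q K - M.avgConst e q) := by
  classical
  have hside : ∀ e, (∑ L, M.side L e * M.flux e (M.enrichment K L)) =
      M.side K e * M.flux e (radial (M.centroid K)) := fun e => by
    rw [Finset.sum_eq_single K (fun L _ h => by simp [enrichment, h]) (by simp)]
    simp [enrichment]
  rw [formB_eq, Finset.sum_eq_single K (fun L _ h => by simp [enrichment, h]) (by simp)]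
  simp only [hside]
  rw [← Finset.sum_subset (Finset.subset_univ (M.facetsOf K)) fun e _ he => by
    rw [M.side_of_not_subset fun h => he (M.mem_facetsOf.2 h), zero_mul, zero_mul]]
  rw [Finset.sum_sub_distrib, Finset.sum_const, card_facetsOf, sum_facetsOf, sum_facetsOf]
  simp only [side_mul_flux_radial, coord_centroid, enrichment, Pi.single_eq_same, trace_radial,
    ← Finset.mul_sum, nsmul_eq_mul]
  have hd : (d : ℝ) + 1 ≠ 0 := by positivity
  push_cast
  field_simp

theorem avgConst_of_subset {e : M.Facet} {K L : M.Elem} (hK : e.1 ⊆ K.1) (hL : e.1 ⊆ L.1)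
    (hKL : K ≠ L) (q : M.BrokenP0) : M.avgConst e q = (q K + q L) / 2 := by
  rcases M.eq_plus_or_minus hK with rfl | ⟨hi, rfl⟩
  · rcases M.eq_plus_or_minus hL with rfl | ⟨hi, rfl⟩
    · exact absurd rfl hKL
    · exact M.avgConst_of_interior hi q
  · rcases M.eq_plus_or_minus hL with rfl | ⟨hi, rfl⟩
    · rw [M.avgConst_of_interior hi, add_comm]
    · exact absurd rfl hKL

/-- No nonzero pressure is orthogonal to the divergences of all enrichment functions. -/
theorem pressure_eq_zero (hopen : IsOpen Ω) (hconn : IsConnected Ω)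
    (hΩ : interior (closure Ω) = Ω) {q : M.BrokenP0} (hq : q ∈ M.pressure)
    (h : ∀ v ∈ M.velocity, M.formB v q = 0) : q = 0 := by
  have := M.nonempty_elem hconn
  have hd : (0 : ℝ) < d := by exact_mod_cast Nat.pos_of_ne_zero (NeZero.ne d)
  obtain ⟨K₀, hmax⟩ := Finite.exists_max q
  -- Maximum principle: where `q` is maximal, all terms `q K - {q}` are nonnegative and sum to zero,
  -- so every neighbour attains the maximum as well.
  have hS : {K | q K = q K₀} = Set.univ := by
    refine M.eq_univ_of_adjacent_mem hopen hconn hΩ ⟨K₀, rfl⟩ fun K hK L e heK heL => ?_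
    by_cases hKL : K = L
    · exact hKL ▸ hK
    have hK : q K = q K₀ := hK
    have h0 := h _ (M.enrichment_mem_velocity K)
    rw [formB_enrichment] at h0
    have hpos := M.volumeReal_cell_pos K
    have hsum := (mul_eq_zero.1 h0).resolve_left (by positivity)
    rw [Finset.sum_eq_zero_iff_of_nonneg] at hsum
    · have he := hsum e (M.mem_facetsOf.2 heK)
      rw [M.avgConst_of_subset heK heL hKL] at he
      show q L = q K₀
      linarith
    · intro e' _
      by_cases hi : M.IsInterior e'
      · rw [M.avgConst_of_interior hi]
        linarith [hmax (M.plus e'), hmax (M.minus e')]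
      · rw [M.avgConst_of_not_interior hi]
        linarith [hmax (M.plus e')]
  have hconst : ∀ K, q K = q K₀ := fun K => by
    have : K ∈ {K | q K = q K₀} := hS ▸ Set.mem_univ K
    exact this
  have hmean : ∑ K, ∫ _ in M.cell K, q K = 0 := hq
  simp only [integral_const, smul_eq_mul, hconst, ← Finset.sum_mul, measureReal_restrict_apply_univ]
    at hmean
  have hvol : 0 < ∑ K, volume.real (M.cell K) :=
    Finset.sum_pos (fun K _ => M.volumeReal_cell_pos K) Finset.univ_nonempty
  funext K
  rw [hconst K]
  exact (mul_eq_zero.1 hmean).resolve_left hvol.ne'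

end NeZero

end Mesh

/-! ### Frobenius norm and finite-dimensional saddle point systems -/

theorem frobSq_nonneg {d : ℕ} (L : Space d →ₗ[ℝ] Space d) : 0 ≤ Mesh.frobSq L :=
  Finset.sum_nonneg fun _ _ => sq_nonneg _

theorem eq_zero_of_frobSq_eq_zero {d : ℕ} {L : Space d →ₗ[ℝ] Space d} (h : Mesh.frobSq L = 0) :
    L = 0 := by
  rw [Mesh.frobSq, Finset.sum_eq_zero_iff_of_nonneg fun _ _ => sq_nonneg _] at h
  refine (EuclideanSpace.basisFun (Fin d) ℝ).toBasis.ext fun i => ?_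
  have := h i (Finset.mem_univ i)
  simpa using this

/-- A square saddle point system with only the trivial homogeneous solution is uniquely
solvable. -/
theorem existsUnique_saddlePoint {V Q : Type*} [AddCommGroup V] [Module ℝ V]
    [FiniteDimensional ℝ V] [AddCommGroup Q] [Module ℝ Q] [FiniteDimensional ℝ Q]
    (a : V →ₗ[ℝ] V →ₗ[ℝ] ℝ) (b : V →ₗ[ℝ] Q →ₗ[ℝ] ℝ) (l : V →ₗ[ℝ] ℝ)
    (h : ∀ u p, (∀ v, a u v - b v p = 0) → (∀ q, b u q = 0) → u = 0 ∧ p = 0) :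
    ∃! s : V × Q, (∀ v, a s.1 v - b v s.2 = l v) ∧ ∀ q, b s.1 q = 0 := by
  let Φ : V × Q →ₗ[ℝ] Module.Dual ℝ V × Module.Dual ℝ Q :=
    (a.comp (LinearMap.fst ℝ V Q) - b.flip.comp (LinearMap.snd ℝ V Q)).prod
      (b.comp (LinearMap.fst ℝ V Q))
  have hΦ : ∀ (s : V × Q) (m : Module.Dual ℝ V), Φ s = (m, 0) ↔
      (∀ v, a s.1 v - b v s.2 = m v) ∧ ∀ q, b s.1 q = 0 := fun s m => by
    rw [Prod.ext_iff]
    exact and_congr LinearMap.ext_iff LinearMap.ext_iff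
  have hinj : Function.Injective Φ := by
    rw [injective_iff_map_eq_zero]
    intro s hs
    obtain ⟨h1, h2⟩ := (hΦ s 0).1 hs
    obtain ⟨h3, h4⟩ := h s.1 s.2 h1 h2
    exact Prod.ext h3 h4
  -- A finite-dimensional space and its dual have equal dimension, so injectivity suffices.
  have hsurj : Function.Surjective Φ :=
    (LinearMap.injective_iff_surjective_of_finrank_eq_finrank (by
      rw [Module.finrank_prod, Module.finrank_prod, Subspace.dual_finrank_eq,
        Subspace.dual_finrank_eq])).1 hinj
  obtain ⟨s, hs⟩ := hsurj (l, 0)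
  exact ⟨s, (hΦ s l).1 hs, fun t ht => hinj (((hΦ t l).2 ht).trans hs.symm)⟩

namespace Mesh

variable {d : ℕ} {Ω : Set (Space d)} (M : Mesh Ω)

/-! ### Definiteness of the energy norm -/

theorem continuous_jump (v : M.BrokenP1) (e : M.Facet) :
    Continuous fun x => M.jump (fun K => v K) e x := by
  simp only [jump_eq_sum]
  exact continuous_finsetSum _ fun K _ =>
    ((v K).continuous_of_finiteDimensional).const_smul (M.side K e)

theorem apply_eq_of_linear_eq_zero {w : Space d →ᵃ[ℝ] Space d} (h : w.linear = 0)
    (x y : Space d) : w x = w y := by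
  have := w.linearMap_vsub x y
  rw [h, LinearMap.zero_apply, vsub_eq_sub] at this
  exact sub_eq_zero.1 this.symm

section NeZero

variable [NeZero d]

/-- The outward fluxes of `x ↦ x` through the facets of `K` sum to `d |K|`. If every facet were
interior, the sum over all elements would cancel facet by facet, and the total volume would be zero.
-/
theorem exists_not_isInterior (hconn : IsConnected Ω) : ∃ e, ¬ M.IsInterior e := by
  by_contra! hint
  have := M.nonempty_elem hconn
  have hd : (0 : ℝ) < d := by exact_mod_cast Nat.pos_of_ne_zero (NeZero.ne d)
  -- The jump of the constant 1 across an interior facet is zero.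
  have hside : ∀ e, ∑ K, M.side K e = 0 := fun e => by
    have := M.jump_eq_sum (fun _ _ => (1 : ℝ)) e 0
    rw [jump, if_pos (hint e), sub_self] at this
    simpa using this.symm
  have hcell : ∀ K, d * volume.real (M.cell K) = ∑ e, M.side K e * M.flux e (radial 0) := fun K => by
    rw [← Finset.sum_subset (Finset.subset_univ (M.facetsOf K)) fun e _ he => by
      rw [M.side_of_not_subset fun h => he (M.mem_facetsOf.2 h), zero_mul]]
    simp only [sum_facetsOf, side_mul_flux_radial, ← Finset.mul_sum,
      (M.basis K).sum_coord_apply_eq_one, mul_one]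
  have hpos : 0 < ∑ K, d * volume.real (M.cell K) :=
    Finset.sum_pos (fun K _ => mul_pos hd (M.volumeReal_cell_pos K)) Finset.univ_nonempty
  simp only [hcell] at hpos
  rw [Finset.sum_comm] at hpos
  simp only [← Finset.sum_mul, hside, zero_mul, Finset.sum_const_zero, lt_irrefl] at hpos

/-- Definiteness holds on the whole broken space: zero gradients make `u` piecewise constant, and
zero jumps carry the value 0 from a boundary facet through the connected dual graph. -/
theorem eq_zero_of_energyNorm_eq_zero (hopen : IsOpen Ω) (hconn : IsConnected Ω)
    (hΩ : interior (closure Ω) = Ω) {ρ : ℝ} (hρ : 0 < ρ) {u : M.BrokenP1}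
    (h : M.energyNorm ρ u = 0) : u = 0 := by
  have hsize : ∀ e, 0 < (M.faceSize e)⁻¹ := fun e =>
    inv_pos.2 (Real.rpow_pos_of_pos (M.faceMeasure_pos e) _)
  have hA : ∀ K ∈ Finset.univ, 0 ≤ ∫ _ in M.cell K, frobSq (u K).linear :=
    fun K _ => integral_nonneg fun _ => frobSq_nonneg _
  have hnn : ∀ e x, 0 ≤ (M.faceSize e)⁻¹ * ‖M.jump (fun K => u K) e x‖ ^ 2 :=
    fun e x => mul_nonneg (hsize e).le (sq_nonneg _)
  have hB : ∀ e ∈ Finset.univ, 0 ≤ M.faceIntegral e fun x =>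
      (M.faceSize e)⁻¹ * ‖M.jump (fun K => u K) e x‖ ^ 2 :=
    fun e _ => integral_nonneg fun x => hnn e x
  have hA' := Finset.sum_nonneg hA
  have hB' := Finset.sum_nonneg hB
  rw [energyNorm, Real.sqrt_eq_zero'] at h
  have hB0 := mul_nonneg hρ.le hB'
  have hA1 := (Finset.sum_eq_zero_iff_of_nonneg hA).1 (by linarith)
  have hB1 := (Finset.sum_eq_zero_iff_of_nonneg hB).1
    ((mul_eq_zero.1 (show ρ * _ = 0 by linarith)).resolve_left hρ.ne')
  have hlin : ∀ K, (u K).linear = 0 := fun K => by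
    have := hA1 K (Finset.mem_univ K)
    rw [integral_const, smul_eq_mul, measureReal_restrict_apply_univ] at this
    exact eq_zero_of_frobSq_eq_zero
      ((mul_eq_zero.1 this).resolve_left (M.volumeReal_cell_pos K).ne')
  have hjump : ∀ e, ∀ x ∈ M.face e, M.jump (fun K => u K) e x = 0 := fun e x hx => by
    have := M.eq_zero_of_faceIntegral_eq_zero e
      (continuous_const.mul ((M.continuous_jump u e).norm.pow 2)) (hnn e)
      (hB1 e (Finset.mem_univ e)) hx
    simpa [(hsize e).ne', (inv_pos.1 (hsize e)).ne'] using this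
  have hface : ∀ e : M.Facet, ∃ x, x ∈ M.face e := fun e =>
    (M.facet_nonempty e).imp fun x hx => subset_convexHull ℝ _ hx
  -- The value of `u K` at the origin stands for its constant value, even if the origin is not in
  -- `K`.
  have hadj : ∀ e, M.IsInterior e → u (M.plus e) 0 = u (M.minus e) 0 := fun e he => by
    obtain ⟨x, hx⟩ := hface e
    have := hjump e x hx
    rw [jump, if_pos he, sub_eq_zero] at this
    rwa [apply_eq_of_linear_eq_zero (hlin _) 0 x, apply_eq_of_linear_eq_zero (hlin (M.minus e)) 0 x]
  obtain ⟨e₀, he₀⟩ := M.exists_not_isInterior hconn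
  have hS : {K | u K 0 = 0} = Set.univ := by
    refine M.eq_univ_of_adjacent_mem hopen hconn hΩ ⟨M.plus e₀, ?_⟩ fun K hK L e heK heL => ?_
    · obtain ⟨x, hx⟩ := hface e₀
      have := hjump e₀ x hx
      rw [jump, if_neg he₀] at this
      rwa [Set.mem_ofPred_eq, apply_eq_of_linear_eq_zero (hlin _) 0 x]
    · rw [Set.mem_ofPred_eq] at hK ⊢
      rcases M.eq_plus_or_minus heK with rfl | ⟨hi, rfl⟩ <;>
        rcases M.eq_plus_or_minus heL with rfl | ⟨hj, rfl⟩
      · exact hK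
      · rw [← hadj e hj, hK]
      · rw [hadj e hi, hK]
      · exact hK
  funext K
  have hK : K ∈ {K | u K 0 = 0} := hS ▸ Set.mem_univ K
  ext1 x
  rw [apply_eq_of_linear_eq_zero (hlin K) x 0]
  exact hK

/-! ### Well-posedness -/

theorem existsUnique_isSolution (hopen : IsOpen Ω) (hb : Bornology.IsBounded Ω)
    (hconn : IsConnected Ω) (hΩ : interior (closure Ω) = Ω) {ρ ν κ₁ : ℝ} (hρ : 0 < ρ)
    (hν : 0 < ν) (hκ₁ : 0 < κ₁) {f : Space d → Space d} (hf : MemLp f 2 (volume.restrict Ω))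
    (aD : M.velocity →ₗ[ℝ] M.velocity →ₗ[ℝ] ℝ)
    (hcoer : ∀ v : M.velocity, κ₁ * ν * M.energyNorm ρ v ^ 2 ≤ aD v v) :
    ∃! s : M.velocity × M.pressure, M.IsSolution aD f s.1 s.2 := by
  let l : M.velocity →ₗ[ℝ] ℝ :=
    { toFun := fun v => M.load f v
      map_add' := fun v w => M.load_add hb hf v w
      map_smul' := fun c v => M.load_smul f c v }
  refine existsUnique_saddlePoint aD (M.bilinB.domRestrict₁₂ M.velocity M.pressure) l ?_
  intro u p h1 h2
  -- Test with `v = u`; the second equation with `q = p` removes the pressure term.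
  have hu0 : M.energyNorm ρ u ^ 2 = 0 := by
    have ha : aD u u = 0 := by
      have := h1 u
      rwa [h2 p, sub_zero] at this
    have hle := hcoer u
    rw [ha] at hle
    exact le_antisymm (nonpos_of_mul_nonpos_right hle (mul_pos hκ₁ hν)) (sq_nonneg _)
  have hu : u = 0 := Subtype.ext
    (M.eq_zero_of_energyNorm_eq_zero hopen hconn hΩ hρ (pow_eq_zero_iff two_ne_zero |>.1 hu0))
  refine ⟨hu, Subtype.ext (M.pressure_eq_zero hopen hconn hΩ p.2 fun v hv => ?_)⟩
  have := h1 ⟨v, hv⟩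
  rw [hu, map_zero, LinearMap.zero_apply, zero_sub, neg_eq_zero] at this
  exact this

end NeZero

end Mesh

end EG

theorem mainTheorem4 (d : ℕ) (hd : d = 2 ∨ d = 3) (σ : ℝ) :
    ∃ ρ₀ : ℝ, 0 < ρ₀ ∧ ∀ ρ : ℝ, ρ₀ ≤ ρ →
      ∀ (Ω : Set (EG.Space d)), IsOpen Ω → Bornology.IsBounded Ω → IsConnected Ω →
        interior (closure Ω) = Ω →
      ∀ (M : EG.Mesh Ω), M.ShapeRegular σ →
        (∀ v : M.velocity, ∃! r : M.BrokenP1, M.IsReconstruction v r) ∧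
        ∀ (ν : ℝ), 0 < ν →
        ∀ (f : EG.Space d → EG.Space d), MemLp f 2 (volume.restrict Ω) →
        ∀ (aD : M.velocity →ₗ[ℝ] M.velocity →ₗ[ℝ] ℝ) (κ₁ κ₂ : ℝ), 0 < κ₁ → 0 < κ₂ →
          (∀ v : M.velocity, κ₁ * ν * M.energyNorm ρ v ^ 2 ≤ aD v v) →
          (∀ v w : M.velocity, |aD v w| ≤ κ₂ * ν * M.energyNorm ρ v * M.energyNorm ρ w) →
          ∃! s : M.velocity × M.pressure, M.IsSolution aD f s.1 s.2 := by
  have : NeZero d := ⟨by omega⟩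
  -- The argument needs only `0 < ρ`, so 1 serves as the threshold for every `σ`.
  refine ⟨1, one_pos, fun ρ hρ Ω hopen hb hconn hΩ M _ =>
    ⟨fun v => M.existsUnique_isReconstruction v, fun ν hν f hf aD κ₁ κ₂ hκ₁ _ hcoer _ => ?_⟩⟩
  exact M.existsUnique_isSolution hopen hb hconn hΩ (one_pos.trans_le hρ) hν hκ₁ hf aD hcoer
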